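/- Let $d\ge 2$, $n\ge 1$, and let $\mathbf K\subset\mathbb E^d$ be an $\mathbf o$-symmetric convex body (compact, convex, with nonempty interior, $\mathbf K=-\mathbf K$) whose boundary is of class $C^2$ and has strictly positive Gaussian curvature at every point. Let $\tau_1,\dots,\tau_n>0$. For $\mathbf p_1,\dots,\mathbf p_n\in\mathbb E^d$ let $\mathcal F=\{\mathbf p_i+\tau_i\mathbf K : i=1,\dots,n\}$; call $\mathcal F$ an NS-family if every hyperplane intersecting $\operatorname{conv}(\bigcup\mathcal F)$ intersects a member of $\mathcal F$, and let its $\mathbf K$-circumradius be the smallest $\lambda>0$ such that some translate of $\lambda\mathbf K$ contains $\bigcup\mathcal F$. For $\alpha\in\mathbb R$, let $(S_\alpha)$ be the statement: there are constants $C,D>0$, depending only on $\tau_1,\dots,\tau_n$ and $\mathbf K$, such that whenever $\mathcal F=\{\mathbf p_i+\tau_i\mathbf K\}$ is an NS-family whose $\mathbf K$-circumradius is at least $\left(\sum_{i=1}^n\tau_i\right)-\varepsilon$ for some $0<\varepsilon\le D$, there is a straight line $L$ whose distance from every $\mathbf p_i$ is at most $C\varepsilon^{\alpha}$. Then $(S_{1/2})$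 holds. Moreover, if $n\ge 3$, then the exponent $1/2$ is best possible for every such $\mathbf K$ and all fixed $\tau_1,\dots,\tau_n>0$: there are constants $c,\varepsilon_0>0$ such that for every $0<\varepsilon\le\varepsilon_0$ there is an NS-family $\mathcal F=\{\mathbf p_i+\tau_i\mathbf K\}$ whose $\mathbf K$-circumradius is at least $\left(\sum_{i=1}^n\tau_i\right)-\varepsilon$ and such that every straight line $L$ has distance at least $c\,\varepsilon^{1/2}$ from some $\mathbf p_i$; in particular, $(S_\alpha)$ fails for every $\alpha>1/2$. -/

import Mathlib

open scoped Pointwise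

noncomputable section

/-- Euclidean `d`-space. -/
abbrev Euc (d : ℕ) : Type := EuclideanSpace ℝ (Fin d)

/-- An origin-symmetric convex body: compact, convex, with nonempty interior, and `K = -K`. -/
structure IsSymmConvexBody {d : ℕ} (K : Set (Euc d)) : Prop where
  isCompact : IsCompact K
  convex : Convex ℝ K
  nonempty_interior : (interior K).Nonempty
  symm : ∀ x ∈ K, -x ∈ K

/-- `g` is a local defining function of class `C²` of the set `K` at the point `x`: on an open
neighbourhood `U` of `x`, the function `g` is `C²`, `K` is given by `g ≤ 0`, and `g` vanishes
at `x` with nonzero gradient. -/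
structure IsC2DefiningFunctionAt {d : ℕ} (K : Set (Euc d)) (x : Euc d)
    (U : Set (Euc d)) (g : Euc d → ℝ) : Prop where
  isOpen : IsOpen U
  mem : x ∈ U
  contDiffOn : ContDiffOn ℝ 2 g U
  mem_iff : ∀ y ∈ U, (y ∈ K ↔ g y ≤ 0)
  eq_zero : g x = 0
  gradient_ne_zero : gradient g x ≠ 0

/-- The boundary of `K` is of class `C²`. -/
def HasC2Boundary {d : ℕ} (K : Set (Euc d)) : Prop :=
  ∀ x ∈ frontier K, ∃ (U : Set (Euc d)) (g : Euc d → ℝ), IsC2DefiningFunctionAt K x U g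

/-- The unit normal field `∇g / ‖∇g‖` of the level sets of `g`. It points out of `{g ≤ 0}`. -/
def unitNormal {d : ℕ} (g : Euc d → ℝ) (y : Euc d) : Euc d :=
  ‖gradient g y‖⁻¹ • gradient g y

/-- The tangent space at `x` of the level set of `g` through `x`, as a linear hyperplane. -/
def tangentHyperplane {d : ℕ} (g : Euc d → ℝ) (x : Euc d) : Submodule ℝ (Euc d) :=
  (Submodule.span ℝ {gradient g x})ᗮ

/-- The Weingarten map at `x` of the level set of `g` through `x`: the differential of the
outer unit normal field, on the tangent space. (The differential maps the tangent space to
itself, so the orthogonal projection only adjusts the codomain.) -/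
def weingartenMap {d : ℕ} (g : Euc d → ℝ) (x : Euc d) :
    tangentHyperplane g x →ₗ[ℝ] tangentHyperplane g x :=
  ((tangentHyperplane g x).orthogonalProjectionOnto.comp
    ((fderiv ℝ (unitNormal g) x).comp (tangentHyperplane g x).subtypeL)).toLinearMap

/-- The Gaussian curvature at `x` of the level set of `g` through `x`: the determinant of the
Weingarten map, that is, the product of the principal curvatures (nonnegative if `{g ≤ 0}` is
convex near `x`). -/
def gaussianCurvature {d : ℕ} (g : Euc d → ℝ) (x : Euc d) : ℝ :=
  LinearMap.det (weingartenMap g x)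

/-- The boundary of `K` has positive Gaussian curvature everywhere. The curvature at a boundary
point does not depend on the defining function `g` through which it is computed. -/
def HasPosGaussianCurvature {d : ℕ} (K : Set (Euc d)) : Prop :=
  ∀ x ∈ frontier K, ∀ (U : Set (Euc d)) (g : Euc d → ℝ),
    IsC2DefiningFunctionAt K x U g → 0 < gaussianCurvature g x

/-- The family of positive homothets `p i + τ i K`. -/
def homothets {d n : ℕ} (K : Set (Euc d)) (τ : Fin n → ℝ) (p : Fin n → Euc d) :
    Fin n → Set (Euc d) :=
  fun i => p i +ᵥ τ i • K

/-- The hyperplane `{x | ⟪u, x⟫ = c}` (for `u ≠ 0`). -/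
def hyperplane {d : ℕ} (u : Euc d) (c : ℝ) : Set (Euc d) :=
  {x | inner ℝ u x = c}

/-- A non-separable family: every hyperplane that meets the convex hull of the union of the
family meets a member of the family. -/
def IsNSFamily {d n : ℕ} (F : Fin n → Set (Euc d)) : Prop :=
  ∀ (u : Euc d) (c : ℝ), u ≠ 0 →
    (hyperplane u c ∩ convexHull ℝ (⋃ i, F i)).Nonempty →
      ∃ i, (hyperplane u c ∩ F i).Nonempty

/-- The `K`-circumradius of `X`: the smallest `lam > 0` such that a translate of `lam K`
contains `X`. -/
def circumradius {d : ℕ} (K X : Set (Euc d)) : ℝ :=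
  sInf {lam : ℝ | 0 < lam ∧ ∃ q : Euc d, X ⊆ q +ᵥ lam • K}

/-- A straight line. -/
def IsLine {d : ℕ} (L : AffineSubspace ℝ (Euc d)) : Prop :=
  Module.finrank ℝ L.direction = 1

/-- The families `p i + τ i K` satisfy the stability estimate with exponent `α`. -/
def HasStabilityExponent {d n : ℕ} (K : Set (Euc d)) (τ : Fin n → ℝ) (α : ℝ) : Prop :=
  ∃ C : ℝ, 0 < C ∧ ∃ D : ℝ, 0 < D ∧
    ∀ p : Fin n → Euc d, IsNSFamily (homothets K τ p) →
      ∀ ε : ℝ, 0 < ε → ε ≤ D →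
        (∑ i, τ i) - ε ≤ circumradius K (⋃ i, homothets K τ p i) →
          ∃ L : AffineSubspace ℝ (Euc d), IsLine L ∧
            ∀ i, Metric.infDist (p i) (L : Set (Euc d)) ≤ C * ε ^ α

end

/-! Stability. Put `T = ∑ τ i` and let `q` be the centroid of the `p i` with weights `τ i`. The
circumradius exceeds `T - 2ε`, so `q + (T - 2ε)K` misses a point of the family, and separation gives
a unit vector `u` and a member `k` reaching far in direction `u`
(`exists_direction_of_lt_circumradius`). Project to `u`, write `h` for the support function of `K`
there, and order the resulting intervals by decreasing right end point `r i`. Non-separability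
forces `r k - r i ≤ 2h ∑ τ j`, the sum running over the `j` before `i`, because only those intervals
can cover the gap (`IsNSFamily.sub_le_sum`). The `τ`-weighted sum of these inequalities gives `r k -
⟪u, q⟫ ≤ Th`; as `k` nearly attains this, every single inequality is tight up to `O(ε)`
(`slack_le_of_reach`).

Tightness separates the right end points by a fixed amount, so their order persists for all
directions `w` near `u`. Hence `⟪w, p k - p i⟫ ≤ β h_K(w)` near `u`, with `β` independent of `w`,
and with equality up to `O(ε)` at `w = u`. If `v` is the point of `K` extreme in direction `u`,
uniform strict convexity gives `h_K(w) ≤ ⟪w, v⟫ + O(‖w - u‖²)`. Thus `⟪w - u, p k - p i - βv⟫ ≤ O(‖w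
- u‖² + ε)`, and steps of length `√ε` in all directions yield `‖p k - p i - βv‖ = O(√ε)`: all
centers are near the line through `p k` along `v`. Curvature enters only through
`exists_strong_convexity`: a nonsingular Weingarten map makes the Hessian of a defining function
positive definite on tangent vectors, and compactness makes this uniform.

Sharpness. Let `u` minimize the support function on the unit sphere, with minimum `ρ`; then `K`
contains the ball of radius `ρ` and lies in the slab `|⟪u, y⟫| ≤ ρ`. Shorten a straight touching
chain along `u` by the factor `1 - ε/T`. By Pythagoras this leaves room to move one inner center
sideways by order `√ε` while consecutive inscribed balls still meet, and the width along `u` keeps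
the circumradius at least `T - ε` (`exists_bent_chain`). -/

/-! ### Second-order calculus along lines and Finsler's lemma. -/

section SecondOrder

variable {E : Type*} [NormedAddCommGroup E] [NormedSpace ℝ E]

/-- The first derivative along a line of a function of class `C²` on an open set. -/
theorem hasDerivAt_along_line {U : Set E} (hU : IsOpen U) {g : E → ℝ}
    (hg : ContDiffOn ℝ 2 g U) {v z : E} {t : ℝ} (ht : v + t • z ∈ U) :
    HasDerivAt (fun s : ℝ => g (v + s • z)) (fderiv ℝ g (v + t • z) z) t := by
  have h1 : HasFDerivAt g (fderiv ℝ g (v + t • z)) (v + t • z) :=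
    ((hg.contDiffAt (hU.mem_nhds ht)).differentiableAt (by norm_num)).hasFDerivAt
  have h2 : HasDerivAt (fun s : ℝ => v + s • z) z t := by
    simpa using ((hasDerivAt_id t).smul_const z).const_add v
  exact h1.comp_hasDerivAt t h2

theorem contDiffAt_fderiv_of_contDiffOn_two {U : Set E} (hU : IsOpen U) {g : E → ℝ}
    (hg : ContDiffOn ℝ 2 g U) {y : E} (hy : y ∈ U) : ContDiffAt ℝ 1 (fderiv ℝ g) y :=
  (hg.contDiffAt (hU.mem_nhds hy)).fderiv_right (by norm_num)

/-- The second derivative along a line of a function of class `C²` on an open set. -/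
theorem hasDerivAt_fderiv_along_line {U : Set E} (hU : IsOpen U) {g : E → ℝ}
    (hg : ContDiffOn ℝ 2 g U) {v z : E} {t : ℝ} (ht : v + t • z ∈ U) :
    HasDerivAt (fun s : ℝ => fderiv ℝ g (v + s • z) z)
      (fderiv ℝ (fderiv ℝ g) (v + t • z) z z) t := by
  have h1 : HasFDerivAt (fderiv ℝ g) (fderiv ℝ (fderiv ℝ g) (v + t • z)) (v + t • z) :=
    ((contDiffAt_fderiv_of_contDiffOn_two hU hg ht).differentiableAt (by norm_num)).hasFDerivAt
  have h2 : HasDerivAt (fun s : ℝ => v + s • z) z t := by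
    simpa using ((hasDerivAt_id t).smul_const z).const_add v
  exact (ContinuousLinearMap.apply ℝ ℝ z).hasFDerivAt.comp_hasDerivAt t (h1.comp_hasDerivAt t h2)

/-- A lower bound for the second derivative along a segment gives a second order lower bound. -/
theorem second_order_lower_bound {U : Set E} (hU : IsOpen U) {g : E → ℝ}
    (hg : ContDiffOn ℝ 2 g U) {v z : E} {κ : ℝ}
    (hseg : ∀ t ∈ Set.Icc (0 : ℝ) 1, v + t • z ∈ U)
    (hκ : ∀ t ∈ Set.Icc (0 : ℝ) 1, κ ≤ fderiv ℝ (fderiv ℝ g) (v + t • z) z z) :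
    g v + fderiv ℝ g v z + κ / 2 ≤ g (v + z) := by
  have h1 : ∀ t ∈ Set.Icc (0 : ℝ) 1, HasDerivAt
      (fun s : ℝ => fderiv ℝ g (v + s • z) z - fderiv ℝ g v z - κ * s)
      (fderiv ℝ (fderiv ℝ g) (v + t • z) z z - κ) t := fun t ht => by
    refine ((hasDerivAt_fderiv_along_line hU hg (hseg t ht)).sub_const
      (fderiv ℝ g v z)).sub ((hasDerivAt_id t).const_mul κ) |>.congr_deriv ?_
    rw [mul_one]
  have h2 : ∀ t ∈ Set.Icc (0 : ℝ) 1, HasDerivAt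
      (fun s : ℝ => g (v + s • z) - s * fderiv ℝ g v z - κ / 2 * s ^ 2)
      (fderiv ℝ g (v + t • z) z - fderiv ℝ g v z - κ * t) t := fun t ht => by
    refine ((hasDerivAt_along_line hU hg (hseg t ht)).sub
      ((hasDerivAt_id t).mul_const (fderiv ℝ g v z))).sub
      ((hasDerivAt_pow 2 t).const_mul (κ / 2)) |>.congr_deriv ?_
    norm_num
    ring
  have m1 := monotoneOn_of_hasDerivWithinAt_nonneg (convex_Icc (0 : ℝ) 1)
    (fun t ht => (h1 t ht).continuousAt.continuousWithinAt)
    (fun t ht => (h1 t (interior_subset ht)).hasDerivWithinAt)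
    (fun t ht => sub_nonneg.2 (hκ t (interior_subset ht)))
  have m2 := monotoneOn_of_hasDerivWithinAt_nonneg (convex_Icc (0 : ℝ) 1)
    (fun t ht => (h2 t ht).continuousAt.continuousWithinAt)
    (fun t ht => (h2 t (interior_subset ht)).hasDerivWithinAt)
    (fun t ht => by
      have := m1 (Set.left_mem_Icc.2 zero_le_one) (interior_subset ht) (interior_subset ht).1
      simpa using this)
  have := m2 (Set.left_mem_Icc.2 zero_le_one) (Set.right_mem_Icc.2 zero_le_one) zero_le_one
  norm_num at this
  linarith

/-- The second derivative at a minimum along a line is nonnegative. -/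
theorem second_deriv_nonneg_of_min {U : Set E} (hU : IsOpen U) {g : E → ℝ}
    (hg : ContDiffOn ℝ 2 g U) {x z : E} (hx : x ∈ U) (hgx : g x = 0)
    (hz : fderiv ℝ g x z = 0) (hmin : ∀ t : ℝ, x + t • z ∈ U → 0 ≤ g (x + t • z)) :
    0 ≤ fderiv ℝ (fderiv ℝ g) x z z := by
  have hev : ∀ᶠ t : ℝ in nhds 0, x + t • z ∈ U := by
    have : Continuous fun t : ℝ => x + t • z := by fun_prop
    exact this.continuousAt.eventually (hU.mem_nhds (by simpa using hx))
  have hd1 : deriv (fun s : ℝ => g (x + s • z)) =ᶠ[nhds 0]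
      fun s : ℝ => fderiv ℝ g (x + s • z) z := by
    filter_upwards [hev] with t ht
    exact (hasDerivAt_along_line hU hg ht).deriv
  have hd2 : deriv (deriv (fun s : ℝ => g (x + s • z))) 0 = fderiv ℝ (fderiv ℝ g) x z z := by
    rw [hd1.deriv_eq]
    simpa using (hasDerivAt_fderiv_along_line hU hg (v := x) (z := z) (t := 0)
      (by simpa using hx)).deriv
  by_contra hneg
  have hmax := isLocalMax_of_deriv_deriv_neg (f := fun s : ℝ => g (x + s • z)) (x₀ := 0)
    (by rw [hd2]; exact not_le.1 hneg) (by rw [hd1.eq_of_nhds]; simpa using hz)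
    (by
      have := hasDerivAt_along_line hU hg (v := x) (z := z) (t := 0) (by simpa using hx)
      exact this.continuousAt)
  -- A local maximum with value `0` of a nonnegative function makes it vanish near `0`, so its
  -- second derivative is `0` after all.
  have hzero : (fun s : ℝ => g (x + s • z)) =ᶠ[nhds 0] fun _ => 0 := by
    filter_upwards [hev, hmax] with t ht ht'
    have : g (x + t • z) ≤ 0 := by simpa [hgx] using ht'
    exact le_antisymm this (hmin t ht)
  have : deriv (deriv (fun s : ℝ => g (x + s • z))) 0 = 0 := by
    rw [hzero.deriv.deriv_eq]
    simp
  rw [hd2] at this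
  exact hneg this.ge

/-- Finsler's lemma: a quadratic form that is positive on the kernel of a linear form becomes
positive definite when a multiple of the square of the linear form is added. -/
theorem exists_add_sq_pos [FiniteDimensional ℝ E] (B : E →L[ℝ] E →L[ℝ] ℝ) (l : E →L[ℝ] ℝ)
    (hpos : ∀ z, l z = 0 → z ≠ 0 → 0 < B z z) :
    ∃ A : ℝ, 0 < A ∧ ∃ m : ℝ, 0 < m ∧
      ∀ z ∈ Metric.sphere (0 : E) 1, m < B z z + A * l z ^ 2 := by
  have hS : IsCompact (Metric.sphere (0 : E) 1) := isCompact_sphere 0 1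
  have hBc : Continuous fun z => B z z := by fun_prop
  obtain ⟨b, hb⟩ := (hS.image hBc).isBounded.bddBelow
  have hb' : ∀ z ∈ Metric.sphere (0 : E) 1, b ≤ B z z := fun z hz => hb ⟨z, hz, rfl⟩
  have hN : IsCompact (Metric.sphere (0 : E) 1 ∩ {z | B z z ≤ 0}) :=
    hS.inter_right (isClosed_le hBc continuous_const)
  have hδ : ∃ δ : ℝ, 0 < δ ∧ ∀ z ∈ Metric.sphere (0 : E) 1 ∩ {z | B z z ≤ 0}, δ ≤ l z ^ 2 := by
    have := hN.exists_forall_le' (f := fun z => l z ^ 2) (a := 0) (by fun_prop) (fun z hz => by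
      have hz0 : z ≠ 0 := by
        rintro rfl
        simp at hz
      have : l z ≠ 0 := fun h => absurd (hpos z h hz0) (not_lt.2 hz.2)
      positivity)
    exact this
  obtain ⟨δ, hδ, hδ'⟩ := hδ
  -- Where `B z z ≤ 0`, the added term is at least `|b| + 1`, which outweighs the lower bound `b` of
  -- `B` on the sphere.
  refine ⟨(|b| + 1) / δ, by positivity, ?_⟩
  have hpos' : ∀ z ∈ Metric.sphere (0 : E) 1, 0 < B z z + (|b| + 1) / δ * l z ^ 2 := by
    intro z hz
    by_cases h : B z z ≤ 0
    · have h1 := hδ' z ⟨hz, h⟩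
      have h2 : (|b| + 1) / δ * δ ≤ (|b| + 1) / δ * l z ^ 2 := by gcongr
      rw [div_mul_cancel₀ _ hδ.ne'] at h2
      have := hb' z hz
      have := neg_abs_le b
      linarith
    · have : 0 ≤ (|b| + 1) / δ * l z ^ 2 := by positivity
      linarith
  obtain ⟨m, hm, hm'⟩ := hS.exists_forall_le' (a := 0)
    (f := fun z => B z z + (|b| + 1) / δ * l z ^ 2) (by fun_prop) hpos'
  exact ⟨m / 2, by positivity, fun z hz => by have := hm' z hz; linarith⟩

end SecondOrder

/-! ### Defining functions of a convex body: supporting hyperplanes, Hessian, normals. -/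

section DefiningFunction

variable {d : ℕ} {K U : Set (Euc d)} {x v : Euc d} {g : Euc d → ℝ}

theorem IsC2DefiningFunctionAt.continuousOn (hg : IsC2DefiningFunctionAt K x U g) :
    ContinuousOn g U := hg.contDiffOn.continuousOn

theorem IsC2DefiningFunctionAt.mem_interior_of_neg (hg : IsC2DefiningFunctionAt K x U g)
    (hv : v ∈ U) (hneg : g v < 0) : v ∈ interior K := by
  rw [mem_interior_iff_mem_nhds]
  have h1 := (hg.continuousOn.continuousAt (hg.isOpen.mem_nhds hv)).eventually_lt_const hneg
  filter_upwards [h1, hg.isOpen.mem_nhds hv] with y hy hyU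
  exact (hg.mem_iff y hyU).2 hy.le

theorem IsC2DefiningFunctionAt.eq_zero_of_mem_frontier (hg : IsC2DefiningFunctionAt K x U g)
    (hK : IsClosed K) (hv : v ∈ U) (hvf : v ∈ frontier K) : g v = 0 := by
  have h1 : g v ≤ 0 := (hg.mem_iff v hv).1 (hK.frontier_subset hvf)
  refine h1.antisymm (not_lt.1 fun h => ?_)
  exact hvf.2 (hg.mem_interior_of_neg hv h)

theorem IsC2DefiningFunctionAt.eventually_line_mem (hg : IsC2DefiningFunctionAt K x U g)
    (hv : v ∈ U) (z : Euc d) : ∀ᶠ t : ℝ in nhds 0, v + t • z ∈ U := by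
  have : Continuous fun t : ℝ => v + t • z := by fun_prop
  exact this.continuousAt.eventually (hg.isOpen.mem_nhds (by simpa using hv))

/-- Moving from a zero of `g` in a direction in which `g` decreases leads into `K`. -/
theorem IsC2DefiningFunctionAt.exists_mem_of_fderiv_neg (hg : IsC2DefiningFunctionAt K x U g)
    (hv : v ∈ U) (hgv : g v = 0) {z : Euc d} (hz : fderiv ℝ g v z < 0) :
    ∃ t : ℝ, 0 < t ∧ v + t • z ∈ K := by
  have h1 := hasDerivAt_along_line hg.isOpen hg.contDiffOn (v := v) (z := z) (t := 0)
    (by simpa using hv)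
  have h2 := h1.tendsto_slope_zero_right
  simp only [zero_smul, add_zero, zero_add, hgv, sub_zero, smul_eq_mul] at h2
  have h3 := h2.eventually_lt_const hz
  have h4 := (hg.eventually_line_mem hv z).filter_mono (nhdsWithin_le_nhds (s := Set.Ioi 0))
  obtain ⟨t, ht1, ht2, ht0⟩ := (h3.and (h4.and self_mem_nhdsWithin)).exists
  refine ⟨t, ht0, (hg.mem_iff _ ht2).2 ?_⟩
  have ht0' : (0 : ℝ) < t := ht0
  by_contra hcon
  have : 0 < t⁻¹ * g (v + t • z) := mul_pos (inv_pos.2 ht0') (not_le.1 hcon)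
  linarith

/-- The tangent hyperplane of a convex set is a supporting hyperplane. -/
theorem IsC2DefiningFunctionAt.fderiv_sub_nonpos (hg : IsC2DefiningFunctionAt K x U g)
    (hK : Convex ℝ K) (hv : v ∈ U) (hgv : g v = 0) {y : Euc d} (hy : y ∈ K) :
    fderiv ℝ g v (y - v) ≤ 0 := by
  have hvK : v ∈ K := (hg.mem_iff v hv).2 hgv.le
  have h1 := hasDerivAt_along_line hg.isOpen hg.contDiffOn (v := v) (z := y - v) (t := 0)
    (by simpa using hv)
  have h2 := h1.tendsto_slope_zero_right
  simp only [zero_smul, add_zero, zero_add, hgv, sub_zero, smul_eq_mul] at h2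
  refine le_of_tendsto h2 ?_
  have h4 := (hg.eventually_line_mem hv (y - v)).filter_mono
    (nhdsWithin_le_nhds (s := Set.Ioi 0))
  have h5 : ∀ᶠ t : ℝ in nhdsWithin 0 (Set.Ioi 0), t < 1 :=
    (eventually_lt_nhds zero_lt_one).filter_mono nhdsWithin_le_nhds
  filter_upwards [h4, h5, self_mem_nhdsWithin] with t ht ht1 ht0
  have ht0' : (0 : ℝ) < t := ht0
  have : v + t • (y - v) ∈ K := hK.add_smul_sub_mem hvK hy ⟨ht0'.le, ht1.le⟩
  exact mul_nonpos_of_nonneg_of_nonpos (inv_pos.2 ht0').le ((hg.mem_iff _ ht).1 this)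

/-- The second derivative is nonnegative on tangent vectors. -/
theorem IsC2DefiningFunctionAt.second_deriv_nonneg (hg : IsC2DefiningFunctionAt K x U g)
    (hK : Convex ℝ K) {z : Euc d} (hz : fderiv ℝ g x z = 0) :
    0 ≤ fderiv ℝ (fderiv ℝ g) x z z := by
  refine second_deriv_nonneg_of_min hg.isOpen hg.contDiffOn hg.mem hg.eq_zero hz fun t ht => ?_
  by_contra hneg
  -- A tangent line cannot enter the interior: a further push along the gradient would give a point
  -- of `K` beyond the supporting hyperplane.
  have hint := hg.mem_interior_of_neg ht (not_le.1 hneg)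
  have hev : ∀ᶠ s : ℝ in nhds 0, (x + t • z) + s • gradient g x ∈ K := by
    have : Continuous fun s : ℝ => (x + t • z) + s • gradient g x := by fun_prop
    exact this.continuousAt.eventually
      (by simpa using mem_interior_iff_mem_nhds.1 hint)
  obtain ⟨s, hs, hs0⟩ := ((hev.filter_mono nhdsWithin_le_nhds).and
    (self_mem_nhdsWithin (s := Set.Ioi (0 : ℝ)))).exists
  have h1 := hg.fderiv_sub_nonpos hK hg.mem hg.eq_zero hs
  have h2 : (x + t • z) + s • gradient g x - x = t • z + s • gradient g x := by abel
  have h3 : fderiv ℝ g x (gradient g x) = ‖gradient g x‖ ^ 2 := by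
    rw [← inner_gradient_left, real_inner_self_eq_norm_sq]
  rw [h2, map_add, map_smul, map_smul, hz, h3, smul_zero, zero_add, smul_eq_mul] at h1
  have h4 : 0 < ‖gradient g x‖ := norm_pos_iff.2 hg.gradient_ne_zero
  have h5 : (0 : ℝ) < s := hs0
  have : 0 < s * ‖gradient g x‖ ^ 2 := by positivity
  linarith

/-- The differential of the unit normal field, up to a multiple of the normal. -/
theorem IsC2DefiningFunctionAt.exists_fderiv_unitNormal (hg : IsC2DefiningFunctionAt K x U g)
    (z : Euc d) : ∃ s : ℝ, fderiv ℝ (unitNormal g) x z =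
      ‖gradient g x‖⁻¹ • (InnerProductSpace.toDual ℝ (Euc d)).symm
        (fderiv ℝ (fderiv ℝ g) x z) + s • gradient g x := by
  have h1 : HasFDerivAt (fderiv ℝ g) (fderiv ℝ (fderiv ℝ g) x) x :=
    ((contDiffAt_fderiv_of_contDiffOn_two hg.isOpen hg.contDiffOn hg.mem).differentiableAt
      (by norm_num)).hasFDerivAt
  -- The Riesz map is conjugate-linear in general; over `ℝ` it is repackaged as a linear map for the
  -- chain rule.
  let e : (Euc d →L[ℝ] ℝ) →L[ℝ] Euc d :=
    LinearMap.toContinuousLinearMap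
      { toFun := fun l => (InnerProductSpace.toDual ℝ (Euc d)).symm l
        map_add' := fun l m => map_add _ l m
        map_smul' := fun s l => by simp }
  have h2 : HasFDerivAt (gradient g) (e.comp (fderiv ℝ (fderiv ℝ g) x)) x :=
    e.hasFDerivAt.comp x h1
  have h3 : DifferentiableAt ℝ (fun y => ‖gradient g y‖⁻¹) x :=
    (h2.differentiableAt.norm ℝ hg.gradient_ne_zero).inv (norm_ne_zero_iff.2 hg.gradient_ne_zero)
  have h4 := h3.hasFDerivAt.smul h2
  refine ⟨fderiv ℝ (fun y => ‖gradient g y‖⁻¹) x z, ?_⟩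
  have h5 : fderiv ℝ (unitNormal g) x = _ := h4.fderiv
  rw [h5]
  rfl

/-- If the Gaussian curvature does not vanish, the second derivative is positive definite on
tangent vectors. -/
theorem IsC2DefiningFunctionAt.second_deriv_pos (hg : IsC2DefiningFunctionAt K x U g)
    (hK : Convex ℝ K) (hcurv : gaussianCurvature g x ≠ 0) {z : Euc d}
    (hz : fderiv ℝ g x z = 0) (hz0 : z ≠ 0) : 0 < fderiv ℝ (fderiv ℝ g) x z z := by
  refine lt_of_le_of_ne (hg.second_deriv_nonneg hK hz) fun hzero => hz0 ?_
  have hsymm : ∀ a b, fderiv ℝ (fderiv ℝ g) x a b = fderiv ℝ (fderiv ℝ g) x b a := by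
    have := (hg.contDiffOn.contDiffAt (hg.isOpen.mem_nhds hg.mem)).isSymmSndFDerivAt
      (by simp)
    exact fun a b => this.eq a b
  have hmem : ∀ w, w ∈ tangentHyperplane g x ↔ fderiv ℝ g x w = 0 := fun w => by
    rw [tangentHyperplane, Submodule.mem_orthogonal_singleton_iff_inner_right,
      inner_gradient_left]
  -- A null vector of a positive semidefinite form lies in its radical (discriminant argument), so
  -- `z` lies in the kernel of the Weingarten map.
  have hker : ∀ w, fderiv ℝ g x w = 0 → fderiv ℝ (fderiv ℝ g) x z w = 0 := by
    intro w hw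
    have h1 : ∀ s : ℝ, 0 ≤ fderiv ℝ (fderiv ℝ g) x w w * (s * s) +
        2 * fderiv ℝ (fderiv ℝ g) x z w * s + 0 := fun s => by
      have := hg.second_deriv_nonneg hK (z := z + s • w) (by simp [hz, hw])
      simp only [map_add, map_smul, add_apply,
        smul_apply, smul_eq_mul, ← hzero] at this
      rw [hsymm w z] at this
      linarith
    have h2 := discrim_le_zero h1
    rw [discrim] at h2
    nlinarith [sq_nonneg (fderiv ℝ (fderiv ℝ g) x z w)]
  have hW : weingartenMap g x ⟨z, (hmem z).2 hz⟩ = 0 := by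
    obtain ⟨s, hs⟩ := hg.exists_fderiv_unitNormal z
    change (tangentHyperplane g x).orthogonalProjectionOnto (fderiv ℝ (unitNormal g) x z) = 0
    rw [Submodule.orthogonalProjectionOnto_eq_zero_iff, Submodule.mem_orthogonal']
    intro w hw
    have hw' := (hmem w).1 hw
    rw [hs, inner_add_left, inner_smul_left, inner_smul_left, inner_gradient_left, hw',
      InnerProductSpace.toDual_symm_apply, hker w hw']
    simp
  by_contra hne
  refine hcurv (LinearMap.det_eq_zero_iff_ker_ne_bot.2 fun h => hne ?_)
  have : (⟨z, (hmem z).2 hz⟩ : tangentHyperplane g x) ∈ LinearMap.ker (weingartenMap g x) := hW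
  rw [h, Submodule.mem_bot] at this
  exact congrArg Subtype.val this

/-- An outer normal at a smooth point is a nonnegative multiple of the gradient. -/
theorem IsC2DefiningFunctionAt.exists_eq_smul_gradient (hg : IsC2DefiningFunctionAt K x U g)
    (hv : v ∈ U) (hgv : g v = 0) (hgrad : gradient g v ≠ 0) {u : Euc d}
    (hu : ∀ y ∈ K, inner ℝ u y ≤ inner ℝ u v) : ∃ s : ℝ, 0 ≤ s ∧ u = s • gradient g v := by
  set a := gradient g v with ha
  have ha2 : 0 < ‖a‖ ^ 2 := by
    have := norm_pos_iff.2 hgrad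
    positivity
  have key : ∀ z, inner ℝ a z < 0 → inner ℝ u z ≤ 0 := by
    intro z hz
    rw [ha, inner_gradient_left] at hz
    obtain ⟨t, ht, htK⟩ := hg.exists_mem_of_fderiv_neg hv hgv hz
    have := hu _ htK
    rw [inner_add_right, inner_smul_right] at this
    by_contra h
    have : 0 < t * inner ℝ u z := mul_pos ht (not_le.1 h)
    linarith
  have hua : 0 ≤ inner ℝ u a := by
    have := key (-a) (by rw [inner_neg_right, real_inner_self_eq_norm_sq]; linarith)
    rw [inner_neg_right] at this
    linarith
  set s := inner ℝ u a / ‖a‖ ^ 2 with hs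
  refine ⟨s, by positivity, ?_⟩
  set b := u - s • a with hb
  have hab : inner ℝ a b = 0 := by
    rw [hb, inner_sub_right, inner_smul_right, real_inner_self_eq_norm_sq, hs,
      div_mul_cancel₀ _ ha2.ne', real_inner_comm, sub_self]
  have hub : inner ℝ u b = ‖b‖ ^ 2 := by
    have : u = b + s • a := by rw [hb]; abel
    nth_rewrite 1 [this]
    rw [inner_add_left, inner_smul_left, hab, real_inner_self_eq_norm_sq]
    simp
  -- The part `b` of `u` orthogonal to the gradient, tilted slightly against the gradient, is an
  -- admissible test direction in `key`.
  have hb2 : ‖b‖ ^ 2 ≤ 0 := by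
    refine le_of_forall_pos_le_add fun ε hε => ?_
    have h1 : (0 : ℝ) < ε / (inner ℝ u a + 1) := by positivity
    have h2 := key (b - (ε / (inner ℝ u a + 1)) • a) (by
      rw [inner_sub_right, inner_smul_right, hab, real_inner_self_eq_norm_sq]
      nlinarith)
    rw [inner_sub_right, inner_smul_right, hub] at h2
    have h3 : ε / (inner ℝ u a + 1) * inner ℝ u a ≤ ε := by
      rw [div_mul_eq_mul_div, div_le_iff₀ (by positivity)]
      nlinarith
    linarith
  have : b = 0 := by
    have : ‖b‖ = 0 := by
      have := sq_nonneg ‖b‖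
      exact pow_eq_zero_iff (two_ne_zero) |>.1 (le_antisymm hb2 this)
    exact norm_eq_zero.1 this
  exact sub_eq_zero.1 this

end DefiningFunction

/-! ### From positive curvature to uniform strict convexity. -/

section StrongConvexity

variable {d : ℕ} {K U : Set (Euc d)} {x : Euc d} {g : Euc d → ℝ}

/-- Near a boundary point, the second derivative of a defining function is uniformly positive
definite up to the square of the differential. -/
theorem IsC2DefiningFunctionAt.exists_ball_second_deriv_lower_bound
    (hg : IsC2DefiningFunctionAt K x U g)
    (hpos : ∀ z, fderiv ℝ g x z = 0 → z ≠ 0 → 0 < fderiv ℝ (fderiv ℝ g) x z z) :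
    ∃ r : ℝ, 0 < r ∧ ∃ A : ℝ, 0 < A ∧ ∃ m : ℝ, 0 < m ∧ ∃ b : ℝ, 0 < b ∧
      Metric.ball x r ⊆ U ∧
      (∀ v ∈ Metric.ball x r, gradient g v ≠ 0 ∧ ‖gradient g v‖ ≤ b) ∧
      ∀ ξ ∈ Metric.ball x r, ∀ v ∈ Metric.ball x r, ∀ z,
        m * ‖z‖ ^ 2 ≤ fderiv ℝ (fderiv ℝ g) ξ z z + A * fderiv ℝ g v z ^ 2 := by
  obtain ⟨A, hA, m, hm, hAm⟩ := exists_add_sq_pos _ _ hpos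
  have hC1 := contDiffAt_fderiv_of_contDiffOn_two hg.isOpen hg.contDiffOn hg.mem
  have hc1 : ContinuousAt (fderiv ℝ g) x := hC1.continuousAt
  have hc2 : ContinuousAt (fderiv ℝ (fderiv ℝ g)) x :=
    (hC1.fderiv_right (m := 0) (by norm_num)).continuousAt
  have hcg : ContinuousAt (gradient g) x :=
    (InnerProductSpace.toDual ℝ (Euc d)).symm.continuous.continuousAt.comp hc1
  have h1 : ∀ᶠ q : Euc d × Euc d in nhds (x, x), ∀ z ∈ Metric.sphere (0 : Euc d) 1,
      m < fderiv ℝ (fderiv ℝ g) q.1 z z + A * fderiv ℝ g q.2 z ^ 2 := by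
    refine (isCompact_sphere (0 : Euc d) 1).eventually_forall_of_forall_eventually
      (P := fun (q : Euc d × Euc d) z =>
        m < fderiv ℝ (fderiv ℝ g) q.1 z z + A * fderiv ℝ g q.2 z ^ 2) fun z hz => ?_
    have hz' : ContinuousAt (fun q : (Euc d × Euc d) × Euc d => q.2) ((x, x), z) :=
      continuousAt_snd
    have e1 : ContinuousAt (fun q : (Euc d × Euc d) × Euc d =>
        fderiv ℝ (fderiv ℝ g) q.1.1 q.2 q.2) ((x, x), z) := by
      refine ContinuousAt.clm_apply (ContinuousAt.clm_apply ?_ hz') hz'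
      exact ContinuousAt.comp (f := fun q : (Euc d × Euc d) × Euc d => q.1.1)
        (x := ((x, x), z)) hc2 (by fun_prop)
    have e2 : ContinuousAt (fun q : (Euc d × Euc d) × Euc d =>
        fderiv ℝ g q.1.2 q.2) ((x, x), z) := by
      refine ContinuousAt.clm_apply ?_ hz'
      exact ContinuousAt.comp (f := fun q : (Euc d × Euc d) × Euc d => q.1.2)
        (x := ((x, x), z)) hc1 (by fun_prop)
    exact (e1.add ((e2.pow 2).const_mul A)).eventually_const_lt (hAm z hz)
  obtain ⟨r₁, hr₁, hb₁⟩ := Metric.eventually_nhds_iff_ball.1 h1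
  have h2 : ∀ᶠ v in nhds x, gradient g v ≠ 0 ∧ ‖gradient g v‖ ≤ ‖gradient g x‖ + 1 ∧ v ∈ U :=
    (hcg.eventually_ne hg.gradient_ne_zero).and
      (((hcg.norm.eventually_lt_const (lt_add_one _)).mono fun _ h => h.le).and
        (hg.isOpen.mem_nhds hg.mem))
  obtain ⟨r₂, hr₂, hb₂⟩ := Metric.eventually_nhds_iff_ball.1 h2
  refine ⟨min r₁ r₂, lt_min hr₁ hr₂, A, hA, m, hm, ‖gradient g x‖ + 1, by positivity,
    fun v hv => (hb₂ v (Metric.ball_subset_ball (min_le_right _ _) hv)).2.2,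
    fun v hv => ?_, fun ξ hξ v hv z => ?_⟩
  · have := hb₂ v (Metric.ball_subset_ball (min_le_right _ _) hv)
    exact ⟨this.1, this.2.1⟩
  · by_cases hz : z = 0
    · simp [hz]
    have hz' : 0 < ‖z‖ := norm_pos_iff.2 hz
    have := hb₁ (ξ, v) (by
      rw [← ball_prod_same]
      exact ⟨Metric.ball_subset_ball (min_le_left _ _) hξ,
        Metric.ball_subset_ball (min_le_left _ _) hv⟩) (‖z‖⁻¹ • z)
      (by simp [norm_smul, hz'.ne'])
    simp only [map_smul, smul_apply, smul_eq_mul] at this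
    have e : fderiv ℝ (fderiv ℝ g) ξ z z + A * fderiv ℝ g v z ^ 2 =
        ‖z‖ ^ 2 * (‖z‖⁻¹ * (‖z‖⁻¹ * fderiv ℝ (fderiv ℝ g) ξ z z) +
          A * (‖z‖⁻¹ * fderiv ℝ g v z) ^ 2) := by
      field_simp
    rw [e, mul_comm m]
    gcongr

/-- Local form of the uniform strict convexity of a body with positive curvature. -/
theorem IsC2DefiningFunctionAt.exists_nhds_strong_convexity
    (hg : IsC2DefiningFunctionAt K x U g) (hKc : IsCompact K) (hK : Convex ℝ K)
    (hcurv : gaussianCurvature g x ≠ 0) :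
    ∃ V ∈ nhds x, ∃ c : ℝ, 0 < c ∧ ∀ v ∈ V ∩ frontier K, ∀ u : Euc d, ‖u‖ = 1 →
      (∀ y ∈ K, inner ℝ u y ≤ inner ℝ u v) → ∀ y ∈ K, c * ‖y - v‖ ^ 2 ≤ inner ℝ u (v - y) := by
  obtain ⟨r, hr, A, hA, m, hm, b, hb, hrU, hgrad, hquad⟩ :=
    hg.exists_ball_second_deriv_lower_bound fun z hz hz0 => hg.second_deriv_pos hK hcurv hz hz0
  obtain ⟨Δ, hΔ, hdiam⟩ : ∃ Δ : ℝ, 0 < Δ ∧ ∀ y ∈ K, ∀ v ∈ K, ‖y - v‖ ≤ Δ :=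
    ⟨Metric.diam K + 1, by positivity, fun y hy v hv => by
      have := Metric.dist_le_diam_of_mem hKc.isBounded hy hv
      rw [dist_eq_norm] at this
      linarith⟩
  -- Shrinking `K` towards `v` by this factor brings it into the ball of radius `r` about `x`. The
  -- local estimate then transfers to all of `K` at the cost of a factor `t`.
  set t := min 1 (r / (2 * Δ)) with ht
  have ht0 : 0 < t := by positivity
  have ht1 : t ≤ 1 := min_le_left _ _
  have htΔ : t * Δ ≤ r / 2 := by
    have : t ≤ r / (2 * Δ) := min_le_right _ _
    rw [le_div_iff₀ (by positivity)] at this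
    linarith
  set c := m / (b * (2 + A * (b * (2 * r)))) with hc
  have hc0 : 0 < c := by positivity
  refine ⟨Metric.ball x (r / 2), Metric.ball_mem_nhds _ (by positivity), c * t, by positivity,
    fun v hv u hu hmax => ?_⟩
  have hvr : v ∈ Metric.ball x r := Metric.ball_subset_ball (by linarith) hv.1
  have hgv := hg.eq_zero_of_mem_frontier hKc.isClosed (hrU hvr) hv.2
  have hvK : v ∈ K := hKc.isClosed.frontier_subset hv.2
  obtain ⟨s, hs, hus⟩ := hg.exists_eq_smul_gradient (hrU hvr) hgv (hgrad v hvr).1 hmax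
  have hsb : 1 ≤ s * b := by
    rw [hus, norm_smul, Real.norm_of_nonneg hs] at hu
    rw [← hu]
    gcongr
    exact (hgrad v hvr).2
  have local_bound : ∀ y ∈ K, y ∈ Metric.ball x r → c * ‖y - v‖ ^ 2 ≤ inner ℝ u (v - y) := by
    intro y hy hyr
    have hL := hg.fderiv_sub_nonpos hK (hrU hvr) hgv hy
    have hseg : ∀ τ ∈ Set.Icc (0 : ℝ) 1, v + τ • (y - v) ∈ Metric.ball x r := fun τ hτ =>
      (convex_ball x r).add_smul_sub_mem hvr hyr hτ
    have h1 := second_order_lower_bound hg.isOpen hg.contDiffOn (v := v) (z := y - v)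
      (κ := m * ‖y - v‖ ^ 2 - A * fderiv ℝ g v (y - v) ^ 2)
      (fun τ hτ => hrU (hseg τ hτ))
      (fun τ hτ => by linarith [hquad _ (hseg τ hτ) v hvr (y - v)])
    rw [hgv, add_sub_cancel] at h1
    have h2 := (hg.mem_iff y (hrU hyr)).1 hy
    have h3 : inner ℝ u (v - y) = s * (-fderiv ℝ g v (y - v)) := by
      rw [hus, inner_smul_left, inner_gradient_left, ← map_neg, neg_sub]
      rfl
    have h4 : -fderiv ℝ g v (y - v) ≤ b * (2 * r) := by
      rw [← inner_gradient_left, ← inner_neg_right]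
      refine (real_inner_le_norm _ _).trans ?_
      rw [norm_neg]
      gcongr
      · exact (hgrad v hvr).2
      · rw [← dist_eq_norm]
        have := dist_triangle_right y v x
        have e1 := Metric.mem_ball.1 hyr
        have e2 := Metric.mem_ball.1 hvr
        linarith
    set L := -fderiv ℝ g v (y - v) with hLdef
    have hL' : fderiv ℝ g v (y - v) = -L := by rw [hLdef, neg_neg]
    have hL0 : 0 ≤ L := by linarith
    rw [hL'] at h1
    -- Taylor's bound gives `m‖y - v‖² ≤ 2L + AL²`; the boundedness of `L` absorbs the square into a
    -- linear term.
    have h5 : m * ‖y - v‖ ^ 2 ≤ L * (2 + A * (b * (2 * r))) := by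
      have : A * (L * L) ≤ A * (L * (b * (2 * r))) := by gcongr
      nlinarith
    rw [h3, hc, div_mul_eq_mul_div, div_le_iff₀ (by positivity)]
    have h6 : L * (2 + A * (b * (2 * r))) * 1 ≤ L * (2 + A * (b * (2 * r))) * (s * b) := by
      gcongr
    linarith
  intro y hy
  have hyK : v + t • (y - v) ∈ K := hK.add_smul_sub_mem hvK hy ⟨ht0.le, ht1⟩
  have hball : v + t • (y - v) ∈ Metric.ball x r := by
    have e1 := Metric.mem_ball.1 hv.1
    have e2 : dist (v + t • (y - v)) v ≤ r / 2 := by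
      rw [dist_eq_norm, add_sub_cancel_left, norm_smul, Real.norm_of_nonneg ht0.le]
      exact (mul_le_mul_of_nonneg_left (hdiam y hy v hvK) ht0.le).trans htΔ
    rw [Metric.mem_ball]
    have := dist_triangle (v + t • (y - v)) v x
    linarith
  have h1 := local_bound _ hyK hball
  have h2 : v - (v + t • (y - v)) = t • (v - y) := by
    rw [smul_sub, smul_sub]
    abel
  rw [add_sub_cancel_left, norm_smul, Real.norm_of_nonneg ht0.le, h2, inner_smul_right] at h1
  have h3 : t * (c * t * ‖y - v‖ ^ 2) ≤ t * inner ℝ u (v - y) := by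
    calc _ = c * (t * ‖y - v‖) ^ 2 := by ring
      _ ≤ _ := h1
  exact le_of_mul_le_mul_left h3 ht0

/-- A maximizer of a nonzero linear functional is a boundary point. -/
theorem mem_frontier_of_inner_le {u v : Euc d} (hu : u ≠ 0) (hv : v ∈ K)
    (hmax : ∀ y ∈ K, inner ℝ u y ≤ inner ℝ u v) : v ∈ frontier K := by
  refine ⟨subset_closure hv, fun hint => ?_⟩
  have hev : ∀ᶠ s : ℝ in nhds 0, v + s • u ∈ K := by
    have : Continuous fun s : ℝ => v + s • u := by fun_prop
    exact this.continuousAt.eventually (by simpa using mem_interior_iff_mem_nhds.1 hint)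
  obtain ⟨s, hs, hs0⟩ := ((hev.filter_mono nhdsWithin_le_nhds).and
    (self_mem_nhdsWithin (s := Set.Ioi (0 : ℝ)))).exists
  have h1 := hmax _ hs
  rw [inner_add_right, inner_smul_right, real_inner_self_eq_norm_sq] at h1
  have h2 : 0 < ‖u‖ := norm_pos_iff.2 hu
  have h3 : (0 : ℝ) < s := hs0
  have : 0 < s * ‖u‖ ^ 2 := by positivity
  linarith

/-- A body with `C²` boundary of positive curvature is uniformly strictly convex. -/
theorem exists_strong_convexity (hKc : IsCompact K) (hK : Convex ℝ K) (hC2 : HasC2Boundary K)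
    (hcurv : HasPosGaussianCurvature K) :
    ∃ c : ℝ, 0 < c ∧ ∀ u : Euc d, ‖u‖ = 1 → ∀ v ∈ K,
      (∀ y ∈ K, inner ℝ u y ≤ inner ℝ u v) →
        ∀ y ∈ K, c * ‖y - v‖ ^ 2 ≤ inner ℝ u (v - y) := by
  have hfc : IsCompact (frontier K) :=
    hKc.of_isClosed_subset isClosed_frontier hKc.isClosed.frontier_subset
  -- The doubled `frontier K` fits the predicate of the compactness induction, whose first factor is
  -- replaced by small neighbourhoods.
  have main : ∃ c : ℝ, 0 < c ∧ ∀ v ∈ frontier K ∩ frontier K, ∀ u : Euc d, ‖u‖ = 1 →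
      (∀ y ∈ K, inner ℝ u y ≤ inner ℝ u v) →
        ∀ y ∈ K, c * ‖y - v‖ ^ 2 ≤ inner ℝ u (v - y) := by
    refine hfc.induction_on (p := fun V => ∃ c : ℝ, 0 < c ∧ ∀ v ∈ V ∩ frontier K,
      ∀ u : Euc d, ‖u‖ = 1 → (∀ y ∈ K, inner ℝ u y ≤ inner ℝ u v) →
        ∀ y ∈ K, c * ‖y - v‖ ^ 2 ≤ inner ℝ u (v - y)) ?_ ?_ ?_ ?_
    · exact ⟨1, one_pos, fun v hv => absurd hv.1 (Set.notMem_empty v)⟩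
    · rintro V W hVW ⟨c, hc, h⟩
      exact ⟨c, hc, fun v hv => h v ⟨hVW hv.1, hv.2⟩⟩
    · rintro V W ⟨c, hc, h⟩ ⟨c', hc', h'⟩
      refine ⟨min c c', lt_min hc hc', fun v hv u hu hmax y hy => ?_⟩
      rcases hv.1 with hV | hW
      · refine le_trans ?_ (h v ⟨hV, hv.2⟩ u hu hmax y hy)
        gcongr
        exact min_le_left _ _
      · refine le_trans ?_ (h' v ⟨hW, hv.2⟩ u hu hmax y hy)
        gcongr
        exact min_le_right _ _
    · intro x hx
      obtain ⟨U, g, hg⟩ := hC2 x hx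
      obtain ⟨V, hV, h⟩ :=
        hg.exists_nhds_strong_convexity hKc hK (hcurv x hx U g hg).ne'
      exact ⟨V, mem_nhdsWithin_of_mem_nhds hV, h⟩
  obtain ⟨c, hc, h⟩ := main
  refine ⟨c, hc, fun u hu v hv hmax => ?_⟩
  have hvf := mem_frontier_of_inner_le (by rintro rfl; simp at hu) hv hmax
  exact h v ⟨hvf, hvf⟩ u hu hmax

end StrongConvexity

/-! ### Support functions, and what circumradius and non-separability say in one direction. -/

section SupportFunction

variable {d : ℕ} {K : Set (Euc d)}

/-- The support function of `K`. -/
noncomputable def supportFun (K : Set (Euc d)) (w : Euc d) : ℝ :=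
  sSup ((fun y => inner ℝ w y) '' K)

theorem inner_le_supportFun (hK : IsCompact K) (w : Euc d) {y : Euc d} (hy : y ∈ K) :
    inner ℝ w y ≤ supportFun K w :=
  le_csSup (hK.image (by fun_prop)).bddAbove ⟨y, hy, rfl⟩

theorem exists_inner_eq_supportFun (hK : IsCompact K) (hne : K.Nonempty) (w : Euc d) :
    ∃ v ∈ K, inner ℝ w v = supportFun K w :=
  (hK.image (f := fun y => inner ℝ w y) (by fun_prop)).sSup_mem (hne.image _)

theorem supportFun_smul (hK : IsCompact K) (hne : K.Nonempty) {s : ℝ} (hs : 0 ≤ s)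
    (w : Euc d) : supportFun K (s • w) = s * supportFun K w := by
  apply le_antisymm
  · obtain ⟨v, hv, h⟩ := exists_inner_eq_supportFun hK hne (s • w)
    rw [← h, real_inner_smul_left]
    exact mul_le_mul_of_nonneg_left (inner_le_supportFun hK w hv) hs
  · obtain ⟨v, hv, h⟩ := exists_inner_eq_supportFun hK hne w
    rw [← h, ← real_inner_smul_left]
    exact inner_le_supportFun hK _ hv

theorem mul_norm_le_supportFun (hK : IsCompact K) {ρ : ℝ} (hρ : 0 ≤ ρ)
    (hball : Metric.closedBall 0 ρ ⊆ K) (w : Euc d) : ρ * ‖w‖ ≤ supportFun K w := by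
  by_cases hw : w = 0
  · subst hw
    have := inner_le_supportFun hK (0 : Euc d) (hball (Metric.mem_closedBall_self hρ))
    simpa using this
  have hw' : ‖w‖ ≠ 0 := norm_ne_zero_iff.2 hw
  have := inner_le_supportFun hK w (y := (ρ / ‖w‖) • w) (hball (by
    rw [mem_closedBall_zero_iff, norm_smul, norm_div, norm_norm, div_mul_cancel₀ _ hw',
      Real.norm_of_nonneg hρ]))
  rw [real_inner_smul_right, real_inner_self_eq_norm_sq] at this
  calc ρ * ‖w‖ = ρ / ‖w‖ * ‖w‖ ^ 2 := by field_simp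
    _ ≤ _ := this

theorem supportFun_sub_le (hK : IsCompact K) (hne : K.Nonempty) {R : ℝ}
    (hR : K ⊆ Metric.closedBall 0 R) (w u : Euc d) :
    supportFun K w - supportFun K u ≤ R * ‖w - u‖ := by
  obtain ⟨v, hv, h⟩ := exists_inner_eq_supportFun hK hne w
  have h1 := inner_le_supportFun hK u hv
  have h2 : inner ℝ (w - u) v ≤ ‖w - u‖ * R :=
    (real_inner_le_norm _ _).trans (by
      gcongr
      exact mem_closedBall_zero_iff.1 (hR hv))
  rw [inner_sub_left, h] at h2
  linarith

theorem supportFun_le (hK : IsCompact K) (hne : K.Nonempty) {R : ℝ}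
    (hR : K ⊆ Metric.closedBall 0 R) (w : Euc d) : supportFun K w ≤ R * ‖w‖ := by
  obtain ⟨v, hv, h⟩ := exists_inner_eq_supportFun hK hne w
  rw [← h, mul_comm]
  exact (real_inner_le_norm _ _).trans (by
    gcongr
    exact mem_closedBall_zero_iff.1 (hR hv))

/-- If `a` is an interior point and `y` is small, then `y` is the midpoint of `a + y` and `-(a -
y)`, both in `K`. -/
theorem IsSymmConvexBody.exists_closedBall_subset (hK : IsSymmConvexBody K) :
    ∃ ρ : ℝ, 0 < ρ ∧ Metric.closedBall 0 ρ ⊆ K := by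
  obtain ⟨a, ha⟩ := hK.nonempty_interior
  obtain ⟨r, hr, hb⟩ := Metric.mem_nhds_iff.1 (mem_interior_iff_mem_nhds.1 ha)
  refine ⟨r / 2, by positivity, fun y hy => ?_⟩
  have hyr : ‖y‖ < r := by
    have := mem_closedBall_zero_iff.1 hy
    linarith
  have h1 : a + y ∈ K := hb (by simpa [dist_eq_norm] using hyr)
  have h2 : -(a - y) ∈ K := hK.symm _ (hb (by simpa [dist_eq_norm] using hyr))
  have := hK.convex h1 h2 (a := 1 / 2) (b := 1 / 2) (by norm_num) (by norm_num) (by norm_num)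
  convert this using 1
  module

theorem IsSymmConvexBody.exists_subset_closedBall (hK : IsSymmConvexBody K) :
    ∃ R : ℝ, 0 < R ∧ K ⊆ Metric.closedBall 0 R := by
  obtain ⟨R, hR⟩ := hK.isCompact.isBounded.subset_closedBall 0
  exact ⟨max R 1, by positivity, hR.trans (Metric.closedBall_subset_closedBall (le_max_left _ _))⟩

theorem mem_homothets_iff {n : ℕ} {τ : Fin n → ℝ} {p : Fin n → Euc d} {i : Fin n} {x : Euc d} :
    x ∈ homothets K τ p i ↔ ∃ y ∈ K, p i + τ i • y = x := by
  simp [homothets, Set.mem_vadd_set, Set.mem_smul_set]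

/-- If `λ` is less than the circumradius then, seen from any center `q` in a suitable direction
`u`, some member of the family reaches at least as far as `λ K`. -/
theorem exists_direction_of_lt_circumradius {n : ℕ} {τ : Fin n → ℝ} {p : Fin n → Euc d}
    (hK : IsSymmConvexBody K) (hτ : ∀ i, 0 < τ i) {lam : ℝ} (hlam : 0 < lam)
    (hlt : lam < circumradius K (⋃ i, homothets K τ p i)) (q : Euc d) :
    ∃ k, ∃ u : Euc d, ‖u‖ = 1 ∧
      lam * supportFun K u ≤ inner ℝ u (p k - q) + τ k * supportFun K u := by
  have hne : K.Nonempty := hK.nonempty_interior.mono interior_subset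
  have hnot : ¬ (⋃ i, homothets K τ p i) ⊆ q +ᵥ lam • K := fun h =>
    not_le.2 hlt (csInf_le ⟨0, fun _ hl => hl.1.le⟩ ⟨hlam, q, h⟩)
  obtain ⟨x, hx, hxq⟩ := Set.not_subset.1 hnot
  obtain ⟨k, hk⟩ := Set.mem_iUnion.1 hx
  obtain ⟨y, hy, rfl⟩ := mem_homothets_iff.1 hk
  have hconv : Convex ℝ (q +ᵥ lam • K) := (hK.convex.smul lam).vadd q
  have hclosed : IsClosed (q +ᵥ lam • K) := (hK.isCompact.smul lam).isClosed.vadd q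
  obtain ⟨f, s, hfs, hsf⟩ := geometric_hahn_banach_closed_point hconv hclosed hxq
  set u := (InnerProductSpace.toDual ℝ (Euc d)).symm f with hu
  have hfu : ∀ z, f z = inner ℝ u z := fun z => by
    rw [hu, InnerProductSpace.toDual_symm_apply]
  obtain ⟨v, hv, hvu⟩ := exists_inner_eq_supportFun hK.isCompact hne u
  have h1 := hfs (q + lam • v) (Set.mem_vadd_set.2 ⟨lam • v, Set.smul_mem_smul_set hv, rfl⟩)
  have h2 := h1.trans hsf
  rw [hfu, hfu, inner_add_right, inner_add_right, real_inner_smul_right,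
    real_inner_smul_right, hvu] at h2
  have h3 : τ k * inner ℝ u y ≤ τ k * supportFun K u :=
    mul_le_mul_of_nonneg_left (inner_le_supportFun hK.isCompact u hy) (hτ k).le
  have h4 : lam * supportFun K u < inner ℝ u (p k - q) + τ k * supportFun K u := by
    rw [inner_sub_right]
    linarith
  have hu0 : u ≠ 0 := by
    intro h0
    rw [h0] at h2
    simp only [inner_zero_left, zero_add, mul_zero] at h2
    rw [h0, inner_zero_left] at hvu
    rw [← hvu] at h2
    simp at h2
  refine ⟨k, ‖u‖⁻¹ • u, ?_, ?_⟩
  · rw [norm_smul, norm_inv, norm_norm, inv_mul_cancel₀ (norm_ne_zero_iff.2 hu0)]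
  · rw [supportFun_smul hK.isCompact hne (by positivity), real_inner_smul_left]
    have := mul_le_mul_of_nonneg_left h4.le (inv_nonneg.2 (norm_nonneg u))
    linarith

/-- In a non-separable family, the right end points of the projections to a line are close:
the gap is covered by the projections reaching further. -/
theorem IsNSFamily.sub_le_sum {n : ℕ} {τ : Fin n → ℝ} {p : Fin n → Euc d}
    (hK : IsSymmConvexBody K) (hτ : ∀ i, 0 < τ i) (hNS : IsNSFamily (homothets K τ p))
    {w : Euc d} (hw : w ≠ 0) (k i : Fin n) (S : Finset (Fin n))
    (hS : ∀ j, inner ℝ w (p i) + τ i * supportFun K w < inner ℝ w (p j) + τ j * supportFun K w →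
      j ∈ S) :
    (inner ℝ w (p k) + τ k * supportFun K w) - (inner ℝ w (p i) + τ i * supportFun K w) ≤
      2 * (∑ j ∈ S, τ j) * supportFun K w := by
  have hne : K.Nonempty := hK.nonempty_interior.mono interior_subset
  set h := supportFun K w with hh
  set r : Fin n → ℝ := fun j => inner ℝ w (p j) + τ j * h with hr
  obtain ⟨v, hv, hvw⟩ := exists_inner_eq_supportFun hK.isCompact hne w
  have hneg : ∀ y ∈ K, -h ≤ inner ℝ w y := fun y hy => by
    have := inner_le_supportFun hK.isCompact w (hK.symm y hy)
    rw [inner_neg_right] at this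
    linarith
  have h0 : 0 ≤ h := by
    have := hneg v hv
    rw [hvw] at this
    linarith
  have hmem : ∀ j, p j + τ j • v ∈ convexHull ℝ (⋃ i, homothets K τ p i) := fun j =>
    subset_convexHull ℝ _ (Set.mem_iUnion.2 ⟨j, mem_homothets_iff.2 ⟨v, hv, rfl⟩⟩)
  have hval : ∀ j, inner ℝ w (p j + τ j • v) = r j := fun j => by
    rw [inner_add_right, real_inner_smul_right, hvw]
  -- Each hyperplane at a level in the gap meets the hull, hence some member. That member ends
  -- beyond `r i`, so its index is in `S`. Comparing lengths gives the claim.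
  have hcover : Set.Ioc (r i) (r k) ⊆ ⋃ j ∈ S, Set.Icc (r j - 2 * τ j * h) (r j) := by
    intro t ht
    have hik : 0 < r k - r i := by linarith [ht.1, ht.2]
    obtain ⟨j, x, hx, hxj⟩ := hNS w t hw
      ⟨(p i + τ i • v) + ((t - r i) / (r k - r i)) • ((p k + τ k • v) - (p i + τ i • v)), by
        change inner ℝ w _ = t
        rw [inner_add_right, real_inner_smul_right, inner_sub_right, hval, hval]
        field_simp
        ring,
      (convex_convexHull ℝ _).add_smul_sub_mem (hmem i) (hmem k)
        ⟨div_nonneg (by linarith [ht.1]) hik.le, (div_le_one hik).2 (by linarith [ht.2])⟩⟩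
    obtain ⟨y, hy, rfl⟩ := mem_homothets_iff.1 hxj
    have hx' : inner ℝ w (p j + τ j • y) = t := hx
    rw [inner_add_right, real_inner_smul_right] at hx'
    have h1 := mul_le_mul_of_nonneg_left (inner_le_supportFun hK.isCompact w hy) (hτ j).le
    have h2 := mul_le_mul_of_nonneg_left (hneg y hy) (hτ j).le
    have hj : t ≤ r j := by
      simp only [hr]
      linarith
    refine Set.mem_iUnion₂.2 ⟨j, hS j (lt_of_lt_of_le ht.1 hj), ?_, hj⟩
    simp only [hr]
    linarith
  have hmeas := (MeasureTheory.measure_mono (μ := MeasureTheory.volume) hcover).trans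
    (MeasureTheory.measure_biUnion_finset_le S _)
  simp only [Real.volume_Ioc, Real.volume_Icc, sub_sub_cancel] at hmeas
  rw [← ENNReal.ofReal_sum_of_nonneg (fun j _ => by have := (hτ j).le; positivity),
    ENNReal.ofReal_le_ofReal_iff
      (Finset.sum_nonneg fun j _ => by have := (hτ j).le; positivity)] at hmeas
  rw [Finset.mul_sum, Finset.sum_mul]
  exact hmeas

end SupportFunction

/-! ### Nearly extremal connected systems of intervals on a line. -/

section OneDimensional

/-- The square of a sum, in terms of any linear ordering of the indices. -/
theorem sq_sum_eq_of_injective {ι β : Type*} [Fintype ι] [LinearOrder β] (e : ι → β)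
    (he : Function.Injective e) (τ : ι → ℝ) :
    (∑ i, τ i) ^ 2 = ∑ i, τ i ^ 2 + 2 * ∑ i, τ i * ∑ j with e j < e i, τ j := by
  classical
  have h1 : ∀ i, ∑ j, τ j = τ i + (∑ j with e j < e i, τ j) + ∑ j with e i < e j, τ j := by
    intro i
    rw [Finset.sum_filter, Finset.sum_filter, ← Finset.sum_ite_eq' Finset.univ i τ |>.trans
      (if_pos (Finset.mem_univ i)), ← Finset.sum_add_distrib, ← Finset.sum_add_distrib]
    refine Finset.sum_congr rfl fun j _ => ?_
    rcases lt_trichotomy (e j) (e i) with h | h | h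
    · have : j ≠ i := by rintro rfl; exact lt_irrefl _ h
      simp [h, this, h.not_gt]
    · have : j = i := he h
      simp [this]
    · have : j ≠ i := by rintro rfl; exact lt_irrefl _ h
      simp [h, this, h.not_gt]
  -- Interchanging the summations swaps the two strict halves of the double sum.
  have h2 : ∑ i, τ i * ∑ j with e i < e j, τ j = ∑ i, τ i * ∑ j with e j < e i, τ j := by
    simp only [Finset.sum_filter, Finset.mul_sum]
    rw [Finset.sum_comm]
    refine Finset.sum_congr rfl fun i _ => Finset.sum_congr rfl fun j _ => ?_
    split_ifs
    · ring
    · ring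
  calc (∑ i, τ i) ^ 2 = ∑ i, τ i * ∑ j, τ j := by rw [sq, Finset.sum_mul]
    _ = ∑ i, (τ i ^ 2 + τ i * (∑ j with e j < e i, τ j) + τ i * ∑ j with e i < e j, τ j) :=
      Finset.sum_congr rfl fun i _ => by rw [h1 i]; ring
    _ = _ := by
      rw [Finset.sum_add_distrib, Finset.sum_add_distrib, h2]
      ring

/-- Order the intervals `[x i - τ i h, x i + τ i h]` by decreasing right end point. If the union
is connected and reaches nearly as far as possible from the weighted centroid `0`, then the
intervals hardly overlap. -/
theorem slack_le_of_reach {ι β : Type*} [Fintype ι] [LinearOrder β] (e : ι → β)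
    (he : Function.Injective e) {τ x : ι → ℝ} (hτ : ∀ i, 0 < τ i) {h δ : ℝ} {k : ι}
    (hx : ∑ i, τ i * x i = 0) (hk : ((∑ i, τ i) - δ) * h ≤ x k + τ k * h)
    (hcov : ∀ i, (x k + τ k * h) - (x i + τ i * h) ≤ 2 * (∑ j with e j < e i, τ j) * h) (i : ι) :
    τ i * (2 * (∑ j with e j < e i, τ j) * h - ((x k + τ k * h) - (x i + τ i * h))) ≤
      (∑ i, τ i) * δ * h := by
  have hT : 0 ≤ ∑ i, τ i := Finset.sum_nonneg fun i _ => (hτ i).le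
  -- All weighted slacks are nonnegative, so each is at most their total, which the centroid
  -- condition evaluates as `T (T h - r k)`.
  refine (Finset.single_le_sum (f := fun i => τ i * (2 * (∑ j with e j < e i, τ j) * h -
    ((x k + τ k * h) - (x i + τ i * h)))) (fun i _ => mul_nonneg (hτ i).le
      (sub_nonneg.2 (hcov i))) (Finset.mem_univ i)).trans ?_
  have h1 : ∑ i, τ i * (2 * (∑ j with e j < e i, τ j) * h -
      ((x k + τ k * h) - (x i + τ i * h))) =
      (2 * ∑ i, τ i * ∑ j with e j < e i, τ j) * h - (∑ i, τ i) * (x k + τ k * h) +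
        ∑ i, τ i * x i + (∑ i, τ i ^ 2) * h := by
    rw [Finset.mul_sum, Finset.sum_mul, Finset.sum_mul, Finset.sum_mul,
      ← Finset.sum_sub_distrib, ← Finset.sum_add_distrib, ← Finset.sum_add_distrib]
    exact Finset.sum_congr rfl fun i _ => by ring
  have h2 := sq_sum_eq_of_injective e he τ
  have h3 := mul_le_mul_of_nonneg_left hk hT
  rw [h1, hx]
  have h4 : 2 * ∑ i, τ i * ∑ j with e j < e i, τ j = (∑ i, τ i) ^ 2 - ∑ i, τ i ^ 2 := by
    linarith
  rw [h4]
  linarith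

end OneDimensional

/-! ### The stability estimate. -/

section Stability

variable {d n : ℕ} {K : Set (Euc d)} {τ : Fin n → ℝ} {p : Fin n → Euc d}

/-- Members of a non-separable family have bounded distances. -/
theorem IsNSFamily.norm_sub_le (hK : IsSymmConvexBody K) (hτ : ∀ i, 0 < τ i)
    (hNS : IsNSFamily (homothets K τ p)) {R : ℝ} (hR : K ⊆ Metric.closedBall 0 R)
    (i j : Fin n) : ‖p j - p i‖ ≤ 3 * (∑ i, τ i) * R := by
  have hne : K.Nonempty := hK.nonempty_interior.mono interior_subset
  have hR0 : 0 ≤ R := by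
    obtain ⟨y, hy⟩ := hne
    exact (norm_nonneg y).trans (mem_closedBall_zero_iff.1 (hR hy))
  have hT : 0 ≤ ∑ i, τ i := Finset.sum_nonneg fun i _ => (hτ i).le
  by_cases h0 : p j - p i = 0
  · rw [h0, norm_zero]
    positivity
  -- Testing non-separability in the direction `p j - p i` itself, with all members allowed to cover
  -- the gap.
  have h1 := hNS.sub_le_sum hK hτ h0 j i Finset.univ fun _ _ => Finset.mem_univ _
  have h2 := supportFun_le hK.isCompact hne hR (p j - p i)
  have h3 : τ i ≤ ∑ i, τ i := Finset.single_le_sum (fun i _ => (hτ i).le) (Finset.mem_univ i)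
  have h4 : inner ℝ (p j - p i) (p j) - inner ℝ (p j - p i) (p i) = ‖p j - p i‖ ^ 2 := by
    rw [← inner_sub_right, real_inner_self_eq_norm_sq]
  have h5 : 0 ≤ supportFun K (p j - p i) := by
    obtain ⟨ρ, hρ, hb⟩ := hK.exists_closedBall_subset
    exact le_trans (by positivity) (mul_norm_le_supportFun hK.isCompact hρ.le hb _)
  have h6 : ‖p j - p i‖ ^ 2 ≤ 3 * (∑ i, τ i) * supportFun K (p j - p i) := by
    have := mul_le_mul_of_nonneg_right h3 h5
    have := mul_nonneg (hτ j).le h5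
    linarith
  have h7 : ‖p j - p i‖ * ‖p j - p i‖ ≤ (3 * (∑ i, τ i) * R) * ‖p j - p i‖ := by
    calc _ = ‖p j - p i‖ ^ 2 := (sq _).symm
      _ ≤ 3 * (∑ i, τ i) * (R * ‖p j - p i‖) := h6.trans (by gcongr)
      _ = _ := by ring
  exact le_of_mul_le_mul_right h7 (norm_pos_iff.2 h0)

/-- The end points of projections vary in a Lipschitz way with the direction. -/
theorem endpoint_diff_le (hK : IsSymmConvexBody K) (hτ : ∀ i, 0 < τ i)
    (hNS : IsNSFamily (homothets K τ p)) {R : ℝ} (hR : K ⊆ Metric.closedBall 0 R)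
    (i j : Fin n) (u w : Euc d) :
    (inner ℝ w (p j) + τ j * supportFun K w) - (inner ℝ w (p i) + τ i * supportFun K w) ≤
      (inner ℝ u (p j) + τ j * supportFun K u) - (inner ℝ u (p i) + τ i * supportFun K u) +
        4 * (∑ i, τ i) * R * ‖w - u‖ := by
  have hne : K.Nonempty := hK.nonempty_interior.mono interior_subset
  have hsingle : ∀ i, τ i ≤ ∑ i, τ i := fun i =>
    Finset.single_le_sum (fun i _ => (hτ i).le) (Finset.mem_univ i)
  have h1 : inner ℝ (w - u) (p j - p i) ≤ ‖w - u‖ * (3 * (∑ i, τ i) * R) :=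
    (real_inner_le_norm _ _).trans (by gcongr; exact hNS.norm_sub_le hK hτ hR i j)
  have h2 : (τ j - τ i) * (supportFun K w - supportFun K u) ≤ (∑ i, τ i) * (R * ‖w - u‖) := by
    refine (le_abs_self _).trans ?_
    rw [abs_mul]
    have e1 : |τ j - τ i| ≤ ∑ i, τ i := abs_le.2
      ⟨by linarith [hτ j, hsingle i], by linarith [hτ i, hsingle j]⟩
    have e2 : |supportFun K w - supportFun K u| ≤ R * ‖w - u‖ := abs_le.2
      ⟨by
        have := supportFun_sub_le hK.isCompact hne hR u w
        rw [norm_sub_rev] at this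
        linarith, supportFun_sub_le hK.isCompact hne hR w u⟩
    exact mul_le_mul e1 e2 (abs_nonneg _) ((abs_nonneg _).trans e1)
  rw [inner_sub_right, inner_sub_left, inner_sub_left] at h1
  linarith

/-- Strict convexity bounds the support function to second order. -/
theorem supportFun_le_of_strong_convexity (hK : IsCompact K) (hne : K.Nonempty) {c : ℝ}
    (hc : 0 < c) {u v : Euc d} (hv : ∀ y ∈ K, c * ‖y - v‖ ^ 2 ≤ inner ℝ u (v - y)) (w : Euc d) :
    supportFun K w ≤ inner ℝ w v + ‖w - u‖ ^ 2 / (4 * c) := by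
  obtain ⟨y, hy, h⟩ := exists_inner_eq_supportFun hK hne w
  have h1 := hv y hy
  have h2 := real_inner_le_norm (w - u) (y - v)
  have h3 : inner ℝ w y = inner ℝ w v + inner ℝ (w - u) (y - v) - inner ℝ u (v - y) := by
    simp only [inner_sub_left, inner_sub_right]
    ring
  have h4 : ‖w - u‖ * ‖y - v‖ - c * ‖y - v‖ ^ 2 ≤ ‖w - u‖ ^ 2 / (4 * c) := by
    rw [le_div_iff₀ (by positivity)]
    nlinarith [sq_nonneg (‖w - u‖ - 2 * c * ‖y - v‖)]
  linarith

/-- A first order inequality, valid near `u` up to a second order error, localizes a vector. -/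
theorem norm_le_of_forall_near {y u : Euc d} {a b ε s₀ : ℝ} (ha : 0 ≤ a) (hb : 0 ≤ b)
    (hε : 0 < ε)
    (hs₀ : ε ≤ s₀ ^ 2) (hs : 0 < s₀)
    (h : ∀ w : Euc d, ‖w - u‖ ≤ s₀ → inner ℝ (w - u) y ≤ a * ‖w - u‖ ^ 2 + b * ε) :
    ‖y‖ ≤ (a + b) * ε ^ (1 / 2 : ℝ) := by
  rw [← Real.sqrt_eq_rpow]
  have hsq : 0 < √ε := Real.sqrt_pos.2 hε
  have hss : √ε * √ε = ε := Real.mul_self_sqrt hε.le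
  have key : ∀ e : Euc d, ‖e‖ = 1 → √ε * inner ℝ e y ≤ (a + b) * ε := fun e he => by
    have hn : ‖√ε • e‖ = √ε := by rw [norm_smul, he, mul_one, Real.norm_of_nonneg hsq.le]
    have := h (u + √ε • e) (by
      rw [add_sub_cancel_left, hn]
      exact Real.sqrt_le_iff.2 ⟨hs.le, hs₀⟩)
    rw [add_sub_cancel_left, hn, real_inner_smul_left, Real.sq_sqrt hε.le] at this
    linarith
  have hab : ∀ e : Euc d, ‖e‖ = 1 → inner ℝ e y ≤ (a + b) * √ε := fun e he => by
    have h1 : √ε * inner ℝ e y ≤ √ε * ((a + b) * √ε) := by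
      calc _ ≤ (a + b) * ε := key e he
        _ = (a + b) * (√ε * √ε) := by rw [hss]
        _ = _ := by ring
    exact le_of_mul_le_mul_left h1 hsq
  by_cases hy : y = 0
  · subst hy
    rw [norm_zero]
    positivity
  · have hy' := norm_ne_zero_iff.2 hy
    have := hab (‖y‖⁻¹ • y) (by rw [norm_smul, norm_inv, norm_norm, inv_mul_cancel₀ hy'])
    rw [real_inner_smul_left, real_inner_self_eq_norm_sq, sq, inv_mul_cancel_left₀ hy'] at this
    exact this

/-- The centers of a non-separable family with nearly maximal circumradius are close to a line. -/
theorem hasStabilityExponent_half (hn : 1 ≤ n) (hK : IsSymmConvexBody K)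
    (hC2 : HasC2Boundary K) (hcurv : HasPosGaussianCurvature K) (hτ : ∀ i, 0 < τ i) :
    HasStabilityExponent K τ (1 / 2) := by
  classical
  have hKc := hK.isCompact
  have hne : K.Nonempty := hK.nonempty_interior.mono interior_subset
  have : Nonempty (Fin n) := ⟨⟨0, hn⟩⟩
  obtain ⟨c, hc, hsc⟩ := exists_strong_convexity hKc hK.convex hC2 hcurv
  obtain ⟨ρ, hρ, hρK⟩ := hK.exists_closedBall_subset
  obtain ⟨R, hR, hRK⟩ := hK.exists_subset_closedBall
  obtain ⟨i₀, hi₀⟩ := Finite.exists_min τ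
  set m := τ i₀ with hm
  have hm0 : 0 < m := hτ i₀
  set T := ∑ i, τ i with hT
  have hsingle : ∀ i, τ i ≤ T := fun i =>
    Finset.single_le_sum (fun i _ => (hτ i).le) (Finset.mem_univ i)
  have hT0 : 0 < T := lt_of_lt_of_le hm0 (hsingle i₀)
  set C₁ := 2 * T * R / m with hC₁
  have hC₁0 : 0 < C₁ := by positivity
  set s₀ := m * ρ / (4 * T * R) with hs₀
  have hs₀0 : 0 < s₀ := by positivity
  -- The three bounds on `ε` keep `T - 2ε` positive, keep the slack `C₁ε` below `mρ`, and make the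
  -- step `√ε` at most `s₀`.
  refine ⟨3 * T / (4 * c) + C₁, by positivity, min (T / 4) (min (m * ρ / C₁) (s₀ ^ 2)),
    by positivity, fun p hNS ε hε hεD hcirc => ?_⟩
  have hεT : ε ≤ T / 4 := hεD.trans (min_le_left _ _)
  have hεC : C₁ * ε ≤ m * ρ := by
    have := hεD.trans ((min_le_right _ _).trans (min_le_left _ _))
    rw [le_div_iff₀ hC₁0] at this
    linarith
  have hεs : ε ≤ s₀ ^ 2 := hεD.trans ((min_le_right _ _).trans (min_le_right _ _))
  set q := T⁻¹ • ∑ i, τ i • p i with hq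
  -- Using `2ε` in place of `ε` turns the weak circumradius hypothesis into a strict inequality.
  obtain ⟨k, u, hu, hk⟩ := exists_direction_of_lt_circumradius hK hτ (lam := T - 2 * ε)
    (by linarith) (by linarith) q
  have hu0 : u ≠ 0 := by
    rintro rfl
    simp at hu
  set h := supportFun K u with hh
  have hhρ : ρ ≤ h := by simpa [hu] using mul_norm_le_supportFun hKc hρ.le hρK u
  have hh0 : 0 ≤ h := hρ.le.trans hhρ
  have hhR : h ≤ R := by simpa [hu] using supportFun_le hKc hne hRK u
  obtain ⟨v, hvK, hvu⟩ := exists_inner_eq_supportFun hKc hne u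
  have hstrong := hsc u hu v hvK fun y hy => by
    rw [hvu]
    exact inner_le_supportFun hKc u hy
  let r : Euc d → Fin n → ℝ := fun w j => inner ℝ w (p j) + τ j * supportFun K w
  -- Decreasing right end point, ties broken by index so that the order is strict.
  let e : Fin n → ℝ ×ₗ Fin n := fun j => toLex (-r u j, j)
  have he : Function.Injective e := fun i j hij => by
    have := congrArg (fun z => (ofLex z).2) hij
    exact this
  have he_lt : ∀ i j, e j < e i ↔ r u i < r u j ∨ r u i = r u j ∧ j < i := fun i j => by
    simp only [e, Prod.Lex.toLex_lt_toLex, neg_lt_neg_iff, neg_inj]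
    exact or_congr Iff.rfl (and_congr_left fun _ => eq_comm)
  set S : Fin n → Finset (Fin n) := fun i => {j | e j < e i} with hS
  have hx : ∑ i, τ i * inner ℝ u (p i - q) = 0 := by
    have : ∀ i, τ i * inner ℝ u (p i - q) = inner ℝ u (τ i • p i) - τ i * inner ℝ u q :=
      fun i => by
        rw [inner_sub_right, real_inner_smul_right u (p i) (τ i), mul_sub]
    rw [Finset.sum_congr rfl fun i _ => this i, Finset.sum_sub_distrib, ← Finset.sum_mul,
      ← inner_sum, hq, real_inner_smul_right]
    field_simp
    ring
  have hcov : ∀ i, r u k - r u i ≤ 2 * (∑ j ∈ S i, τ j) * h := fun i =>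
    hNS.sub_le_sum hK hτ hu0 k i (S i) fun j hj => by
      simp only [hS, Finset.mem_filter, Finset.mem_univ, true_and, he_lt]
      exact Or.inl hj
  have hslack : ∀ i, 2 * (∑ j ∈ S i, τ j) * h - (r u k - r u i) ≤ C₁ * ε := by
    intro i
    have hr : r u k - r u i = (inner ℝ u (p k - q) + τ k * h) -
        (inner ℝ u (p i - q) + τ i * h) := by
      simp only [r, inner_sub_right, ← hh]
      ring
    have h1 := slack_le_of_reach e he hτ (x := fun i => inner ℝ u (p i - q)) (h := h)
      (δ := 2 * ε) (k := k) hx hk (fun i => by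
        have := hcov i
        simp only [r, ← hh] at this
        simp only [inner_sub_right]
        linarith) i
    have h2 : 0 ≤ 2 * (∑ j ∈ S i, τ j) * h - (r u k - r u i) := sub_nonneg.2 (hcov i)
    have h3 : m * (2 * (∑ j ∈ S i, τ j) * h - (r u k - r u i)) ≤ T * (2 * ε) * R := by
      calc _ ≤ τ i * (2 * (∑ j ∈ S i, τ j) * h - (r u k - r u i)) := by
            gcongr
            exact hi₀ i
        _ ≤ T * (2 * ε) * h := by rw [hr]; exact h1
        _ ≤ _ := by gcongr
    rw [hC₁, div_mul_eq_mul_div, le_div_iff₀ hm0]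
    linarith
  -- Subtracting the covering bound for `i` from the near-equality for `j` gives a drop of at least
  -- `2 τ i h - C₁ε ≥ 2mρ - mρ`.
  have hgap : ∀ i j, e i < e j → r u j - r u i ≤ -(m * ρ) := by
    intro i j hij
    have hsub : insert i (S i) ⊆ S j := by
      intro l hl
      simp only [hS, Finset.mem_insert, Finset.mem_filter, Finset.mem_univ, true_and] at hl ⊢
      rcases hl with rfl | hl
      · exact hij
      · exact hl.trans hij
    have hnot : i ∉ S i := by simp [hS]
    have h1 := Finset.sum_le_sum_of_subset_of_nonneg hsub (f := τ) fun l _ _ => (hτ l).le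
    rw [Finset.sum_insert hnot] at h1
    have h2 := hslack j
    have h3 := hcov i
    have h4 : (τ i + ∑ l ∈ S i, τ l) * h ≤ (∑ l ∈ S j, τ l) * h := by gcongr
    have h5 : m * ρ ≤ τ i * h := mul_le_mul (hi₀ i) hhρ hρ.le (hτ i).le
    linarith
  have horder : ∀ w : Euc d, ‖w - u‖ ≤ s₀ → ∀ i j, r w i < r w j → j ∈ S i := by
    intro w hw i j hij
    by_contra hj
    have hne' : e i ≠ e j := fun h' => by
      rw [he h'] at hij
      exact lt_irrefl _ hij
    have hlt : e i < e j := by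
      simp only [hS, Finset.mem_filter, Finset.mem_univ, true_and, not_lt] at hj
      exact lt_of_le_of_ne hj hne'
    have h1 := hgap i j hlt
    have h2 := endpoint_diff_le hK hτ hNS hRK i j u w
    -- `s₀` is chosen so that the Lipschitz change of end point differences cannot exceed the gap,
    -- hence cannot reverse the order.
    have h3 : 4 * T * R * ‖w - u‖ ≤ m * ρ := by
      calc _ ≤ 4 * T * R * s₀ := by gcongr
        _ = m * ρ := by rw [hs₀]; field_simp
    simp only [r] at h1 hij
    linarith
  have hcov' : ∀ w : Euc d, ‖w - u‖ ≤ s₀ → ∀ i,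
      inner ℝ w (p k - p i) ≤ (τ i - τ k + 2 * ∑ j ∈ S i, τ j) * supportFun K w := by
    intro w hw i
    by_cases hw0 : w = 0
    · subst hw0
      obtain ⟨y, -, hy⟩ := exists_inner_eq_supportFun hKc hne (0 : Euc d)
      rw [← hy]
      simp
    have := hNS.sub_le_sum hK hτ hw0 k i (S i) fun j hj => horder w hw i j hj
    rw [inner_sub_right]
    linarith
  have hβ : ∀ i, i ≠ k → 0 ≤ τ i - τ k + 2 * ∑ j ∈ S i, τ j := by
    intro i hik
    -- The slack at `k` itself is `2h ∑ τ j` over `S k`; a single member of `S k` would make it too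
    -- large, so `k` comes first.
    have hki : k ∈ S i := by
      by_contra hk'
      have hlt : e i < e k := by
        simp only [hS, Finset.mem_filter, Finset.mem_univ, true_and, not_lt] at hk'
        exact lt_of_le_of_ne hk' fun h' => hik (he h')
      have hik' : i ∈ S k := by simpa [hS] using hlt
      have h1 := Finset.single_le_sum (f := τ) (fun l _ => (hτ l).le) hik'
      have h2 := hslack k
      have h3 : m * ρ ≤ (∑ l ∈ S k, τ l) * h :=
        mul_le_mul ((hi₀ i).trans h1) hhρ hρ.le ((hτ i).le.trans h1)
      have := mul_pos hm0 hρ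
      linarith
    have := Finset.single_le_sum (f := τ) (fun l _ => (hτ l).le) hki
    have := hτ i
    linarith [hτ k]
  have hv0 : v ≠ 0 := by
    rintro rfl
    rw [inner_zero_right] at hvu
    linarith
  refine ⟨AffineSubspace.mk' (p k) (Submodule.span ℝ {v}), ?_, fun i => ?_⟩
  · rw [IsLine, AffineSubspace.direction_mk']
    exact finrank_span_singleton hv0
  by_cases hik : i = k
  · subst hik
    rw [Metric.infDist_zero_of_mem (AffineSubspace.self_mem_mk' _ _)]
    positivity
  set β := τ i - τ k + 2 * ∑ j ∈ S i, τ j with hβdef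
  have hβ0 : 0 ≤ β := hβ i hik
  have hβT : β ≤ 3 * T := by
    have : ∑ j ∈ S i, τ j ≤ T :=
      Finset.sum_le_sum_of_subset_of_nonneg (Finset.subset_univ _) fun l _ _ => (hτ l).le
    linarith [hsingle i, hτ k]
  have hlow : β * inner ℝ u v - C₁ * ε ≤ inner ℝ u (p k - p i) := by
    have := hslack i
    simp only [r, ← hh] at this
    rw [hvu, inner_sub_right, hβdef]
    linarith
  have hnear := norm_le_of_forall_near (y := p k - p i - β • v) (u := u)
    (a := 3 * T / (4 * c)) (b := C₁) (s₀ := s₀) (by positivity) hC₁0.le hε hεs hs₀0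
    (fun w hw => by
      have h1 := hcov' w hw i
      have h2 := supportFun_le_of_strong_convexity hKc hne hc hstrong w
      have h3 := mul_le_mul_of_nonneg_left h2 hβ0
      have h4 : β * (‖w - u‖ ^ 2 / (4 * c)) ≤ 3 * T * (‖w - u‖ ^ 2 / (4 * c)) := by gcongr
      have h5 : 3 * T / (4 * c) * ‖w - u‖ ^ 2 = 3 * T * (‖w - u‖ ^ 2 / (4 * c)) := by ring
      rw [inner_sub_right, real_inner_smul_right, inner_sub_left, inner_sub_left]
      linarith)
  refine le_trans ?_ hnear
  have hmem : p k + (-β) • v ∈ AffineSubspace.mk' (p k) (Submodule.span ℝ {v}) := by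
    rw [AffineSubspace.mem_mk', vsub_eq_sub, add_sub_cancel_left]
    exact Submodule.smul_mem _ _ (Submodule.mem_span_singleton_self v)
  refine (Metric.infDist_le_dist_of_mem hmem).trans ?_
  rw [dist_comm, dist_eq_norm]
  apply le_of_eq
  congr 1
  module

end Stability

/-! ### Tools for sharpness: chains, an inscribed ball, distances to lines. -/

section Sharpness

variable {d n : ℕ} {K : Set (Euc d)}

theorem Convex.homothets {τ : Fin n → ℝ} {p : Fin n → Euc d} (hK : Convex ℝ K) (i : Fin n) :
    Convex ℝ (homothets K τ p i) := (hK.smul (τ i)).vadd (p i)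

/-- A chain of convex sets in which consecutive sets meet is non-separable. -/
theorem isNSFamily_of_chain {F : Fin n → Set (Euc d)} (hF : ∀ i, Convex ℝ (F i))
    (hchain : ∀ i j : Fin n, j.val = i.val + 1 → (F i ∩ F j).Nonempty)
    (hne : ∀ i, (F i).Nonempty) : IsNSFamily F := by
  rintro w c - ⟨x, hxc, hx⟩
  have hconn : IsPreconnected (⋃ i, F i) := by
    cases n with
    | zero => simpa using isPreconnected_empty
    | succ m =>
      refine IsPreconnected.iUnion_of_chain (fun i => (hF i).isPreconnected) fun i => ?_
      by_cases hi : IsMax i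
      · rw [Order.succ_eq_iff_isMax.2 hi, Set.inter_self]
        exact hne i
      · refine hchain _ _ ?_
        have := Order.covBy_succ_of_not_isMax hi
        have h2 := Fin.covBy_iff.1 this
        exact (Nat.covBy_iff_add_one_eq.1 h2).symm
  -- A connected subset of `ℝ` is an interval, so the union and its convex hull have the same
  -- projection.
  have himg : Convex ℝ (innerSL ℝ w '' ⋃ i, F i) :=
    (hconn.image _ (innerSL ℝ w).continuous.continuousOn).ordConnected.convex
  have hmem : innerSL ℝ w x ∈ innerSL ℝ w '' ⋃ i, F i := by
    have h1 : innerSL ℝ w x ∈ innerSL ℝ w '' convexHull ℝ (⋃ i, F i) := ⟨x, hx, rfl⟩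
    have h2 := (innerSL ℝ w).toLinearMap.image_convexHull (⋃ i, F i)
    have h3 : convexHull ℝ (innerSL ℝ w '' ⋃ i, F i) = innerSL ℝ w '' ⋃ i, F i :=
      himg.convexHull_eq
    rw [← h3]
    exact h2 ▸ h1
  obtain ⟨y, hy, hyx⟩ := hmem
  obtain ⟨i, hi⟩ := Set.mem_iUnion.1 hy
  exact ⟨i, y, Eq.trans hyx hxc, hi⟩

/-- In a direction of minimal width, the body contains a ball touching the supporting
hyperplane. -/
theorem IsSymmConvexBody.exists_inscribed_ball (hd : 2 ≤ d) (hK : IsSymmConvexBody K) :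
    ∃ (ρ : ℝ) (u z : Euc d), 0 < ρ ∧ ‖u‖ = 1 ∧ ‖z‖ = 1 ∧ inner ℝ u z = 0 ∧
      Metric.closedBall 0 ρ ⊆ K ∧ ∀ y ∈ K, inner ℝ u y ≤ ρ := by
  have hne : K.Nonempty := hK.nonempty_interior.mono interior_subset
  obtain ⟨R, hR, hRK⟩ := hK.exists_subset_closedBall
  obtain ⟨r, hr, hrK⟩ := hK.exists_closedBall_subset
  have : Fact (Module.finrank ℝ (Euc d) = (d - 1) + 1) := ⟨by
    rw [finrank_euclideanSpace_fin]
    omega⟩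
  have : Nontrivial (Euc d) := Module.nontrivial_of_finrank_pos (R := ℝ) (by
    rw [finrank_euclideanSpace_fin]
    omega)
  have hcont : Continuous (supportFun K) := by
    refine (LipschitzWith.of_dist_le_mul (K := R.toNNReal) fun w u => ?_).continuous
    rw [Real.dist_eq, dist_eq_norm, abs_le, Real.coe_toNNReal R hR.le]
    have h1 := supportFun_sub_le hK.isCompact hne hRK w u
    have h2 := supportFun_sub_le hK.isCompact hne hRK u w
    rw [norm_sub_rev] at h2
    exact ⟨by linarith, h1⟩
  obtain ⟨u, hu, hmin⟩ := (isCompact_sphere (0 : Euc d) 1).exists_isMinOn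
    (NormedSpace.sphere_nonempty.2 zero_le_one) hcont.continuousOn
  have hu1 : ‖u‖ = 1 := mem_sphere_zero_iff_norm.1 hu
  have hu0 : u ≠ 0 := by
    rintro rfl
    simp at hu1
  have hρ : 0 < supportFun K u := by
    have := mul_norm_le_supportFun hK.isCompact hr.le hrK u
    rw [hu1] at this
    linarith
  -- Minimality of `u` and homogeneity: the support function of `K` dominates that of the ball, so
  -- no point of the ball can be separated from `K`.
  have hlow : ∀ w, supportFun K u * ‖w‖ ≤ supportFun K w := by
    intro w
    by_cases hw : w = 0
    · subst hw
      have := mul_norm_le_supportFun hK.isCompact hr.le hrK 0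
      simpa using this
    have hw' : 0 < ‖w‖ := norm_pos_iff.2 hw
    have h1 : supportFun K u ≤ supportFun K (‖w‖⁻¹ • w) := hmin (by
      rw [mem_sphere_zero_iff_norm, norm_smul, norm_inv, norm_norm, inv_mul_cancel₀ hw'.ne'])
    rw [supportFun_smul hK.isCompact hne (by positivity), ← div_eq_inv_mul,
      le_div_iff₀ hw'] at h1
    exact h1
  have hfin : Module.finrank ℝ (Submodule.span ℝ {u})ᗮ = d - 1 :=
    Submodule.finrank_orthogonal_span_singleton hu0
  have : Nontrivial (Submodule.span ℝ {u})ᗮ := Module.nontrivial_of_finrank_pos (R := ℝ) (by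
    rw [hfin]
    omega)
  obtain ⟨z, hz⟩ := exists_ne (0 : (Submodule.span ℝ {u})ᗮ)
  have hz0 : (z : Euc d) ≠ 0 := fun h => hz (Subtype.ext h)
  have hzu : inner ℝ u (z : Euc d) = 0 :=
    Submodule.mem_orthogonal_singleton_iff_inner_right.1 z.2
  refine ⟨supportFun K u, u, ‖(z : Euc d)‖⁻¹ • (z : Euc d), hρ, hu1, ?_, ?_, fun y hy => ?_,
    fun y hy => inner_le_supportFun hK.isCompact u hy⟩
  · rw [norm_smul, norm_inv, norm_norm, inv_mul_cancel₀ (norm_ne_zero_iff.2 hz0)]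
  · rw [real_inner_smul_right, hzu, mul_zero]
  · by_contra hyK
    obtain ⟨f, s, hfs, hsf⟩ :=
      geometric_hahn_banach_closed_point hK.convex hK.isCompact.isClosed hyK
    set a := (InnerProductSpace.toDual ℝ (Euc d)).symm f with ha
    have hfa : ∀ x, f x = inner ℝ a x := fun x => by
      rw [ha, InnerProductSpace.toDual_symm_apply]
    obtain ⟨v, hv, hva⟩ := exists_inner_eq_supportFun hK.isCompact hne a
    have h1 := (hfs v hv).trans hsf
    rw [hfa, hfa, hva] at h1
    have h2 := hlow a
    have h3 := real_inner_le_norm a y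
    have h4 : ‖a‖ * ‖y‖ ≤ ‖a‖ * supportFun K u := by
      gcongr
      exact mem_closedBall_zero_iff.1 hy
    linarith

/-- A line has a unit direction vector, and the distance of a point from the line dominates the norm of the
component of its displacement orthogonal to the line. -/
theorem IsLine.exists_direction {L : AffineSubspace ℝ (Euc d)} (hL : IsLine L) :
    ∃ (e l : Euc d), ‖e‖ = 1 ∧ ∀ x : Euc d,
      ‖(x - l) - inner ℝ e (x - l) • e‖ ≤ Metric.infDist x (L : Set (Euc d)) := by
  obtain ⟨a, ha0, ha⟩ := finrank_eq_one_iff'.1 hL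
  have ha0' : (a : Euc d) ≠ 0 := fun h => ha0 (Subtype.ext h)
  have hLne : (L : Set (Euc d)).Nonempty := by
    rw [Set.nonempty_iff_ne_empty]
    intro h
    have : L = ⊥ := by
      rw [← AffineSubspace.coe_eq_bot_iff]
      exact h
    rw [IsLine, this, AffineSubspace.direction_bot, finrank_bot] at hL
    exact zero_ne_one hL
  obtain ⟨l, hl⟩ := hLne
  set e : Euc d := ‖(a : Euc d)‖⁻¹ • (a : Euc d) with he
  have he1 : ‖e‖ = 1 := by
    rw [he, norm_smul, norm_inv, norm_norm, inv_mul_cancel₀ (norm_ne_zero_iff.2 ha0')]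
  refine ⟨e, l, he1, fun x => ?_⟩
  refine (Metric.le_infDist ⟨l, hl⟩).2 fun y hy => ?_
  obtain ⟨t, ht⟩ := ha ⟨y - l, AffineSubspace.vsub_mem_direction hy hl⟩
  have hyl : y - l = (t * ‖(a : Euc d)‖) • e := by
    rw [he, smul_smul, mul_assoc, mul_inv_cancel₀ (norm_ne_zero_iff.2 ha0'), mul_one]
    exact (congrArg Subtype.val ht).symm
  have hee : inner ℝ e e = (1 : ℝ) := by rw [real_inner_self_eq_norm_sq, he1, one_pow]
  -- The orthogonal component does not depend on the base point chosen on the line.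
  have h1 : (x - l) - inner ℝ e (x - l) • e = (x - y) - inner ℝ e (x - y) • e := by
    have : x - l = (x - y) + (t * ‖(a : Euc d)‖) • e := by rw [← hyl]; abel
    rw [this, inner_add_right, real_inner_smul_right, hee]
    module
  rw [h1, dist_eq_norm]
  refine abs_le_of_sq_le_sq' ?_ (norm_nonneg _) |>.2
  rw [norm_sub_sq_real, norm_smul, he1, real_inner_smul_right, Real.norm_eq_abs, mul_one,
    sq_abs, real_inner_comm]
  nlinarith [sq_nonneg (inner ℝ e (x - y))]

/-- Three points forming a triangle that is not too flat are not all close to a line. -/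
theorem IsLine.exists_le_infDist {L : AffineSubspace ℝ (Euc d)} (hL : IsLine L)
    {u z a b c : Euc d} (hu : ‖u‖ = 1) (hz : ‖z‖ = 1) (huz : inner ℝ u z = 0) {x y X : ℝ}
    (hx : 0 ≤ x) (hxX : x ≤ X) (hy : 0 ≤ y) (hyX : y ≤ X) (hb : b - a = x • u + y • z)
    (hc : c - a = X • u) {r : ℝ} (hra : Metric.infDist a (L : Set (Euc d)) ≤ r)
    (hrb : Metric.infDist b (L : Set (Euc d)) ≤ r)
    (hrc : Metric.infDist c (L : Set (Euc d)) ≤ r) : y / 8 ≤ r := by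
  obtain ⟨e, l, he, hdist⟩ := hL.exists_direction
  have hX : 0 ≤ X := hx.trans hxX
  let P : Euc d → Euc d := fun v => v - inner ℝ e v • e
  have hP : ∀ p q : Euc d, Metric.infDist p (L : Set (Euc d)) ≤ r →
      Metric.infDist q (L : Set (Euc d)) ≤ r → ‖P (q - p)‖ ≤ 2 * r := by
    intro p q hp hq
    have : P (q - p) = P (q - l) - P (p - l) := by
      simp only [P, inner_sub_right]
      module
    rw [this]
    have h1 := norm_sub_le (P (q - l)) (P (p - l))
    have h2 := (hdist p).trans hp
    have h3 := (hdist q).trans hq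
    simp only [P] at h1 ⊢
    linarith
  have hsq : ∀ v : Euc d, ‖v‖ = 1 → ‖P v‖ ^ 2 = 1 - inner ℝ e v ^ 2 := fun v hv => by
    simp only [P]
    rw [norm_sub_sq_real, norm_smul, he, hv, real_inner_smul_right, Real.norm_eq_abs, mul_one,
      sq_abs, real_inner_comm]
    ring
  -- By Bessel, the line cannot be nearly parallel to both `u` and `z`: one of `‖P u‖`, `‖P z‖` is
  -- at least `1 / 2`.
  have hbessel : inner ℝ e u ^ 2 + inner ℝ e z ^ 2 ≤ (1 : ℝ) := by
    have h1 : 0 ≤ ‖e - (inner ℝ e u • u + inner ℝ e z • z)‖ ^ 2 := sq_nonneg _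
    rw [norm_sub_sq_real, norm_add_sq_real, norm_smul, norm_smul, inner_add_right] at h1
    simp only [real_inner_smul_right, real_inner_smul_left, huz, he, hu, hz,
      Real.norm_eq_abs, mul_one, sq_abs] at h1
    linarith
  have h1 : X * ‖P u‖ ≤ 2 * r := by
    have h := hP a c hra hrc
    have : P (c - a) = X • P u := by
      rw [hc]
      simp only [P, real_inner_smul_right]
      module
    rwa [this, norm_smul, Real.norm_of_nonneg hX] at h
  have h2 : y * ‖P z‖ ≤ 4 * r := by
    have h := hP a b hra hrb
    have : y • P z = P (b - a) - x • P u := by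
      rw [hb]
      simp only [P, real_inner_smul_right, inner_add_right]
      module
    have h3 := norm_sub_le (P (b - a)) (x • P u)
    rw [← this, norm_smul, norm_smul, Real.norm_of_nonneg hx, Real.norm_of_nonneg hy] at h3
    have h4 : x * ‖P u‖ ≤ X * ‖P u‖ := by gcongr
    linarith
  have h3 := hsq u hu
  have h4 := hsq z hz
  by_cases h5 : 1 / 2 ≤ ‖P u‖
  · have : y * (1 / 2) ≤ X * ‖P u‖ := by gcongr
    linarith
  · have h6 : 1 / 2 ≤ ‖P z‖ := by
      have h7 : ‖P u‖ ^ 2 ≤ (1 / 2) ^ 2 := by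
        gcongr
        exact (not_le.1 h5).le
      refine abs_le_of_sq_le_sq' ?_ (norm_nonneg _) |>.2
      linarith
    have : y * (1 / 2) ≤ y * ‖P z‖ := by gcongr
    linarith

end Sharpness

/-! ### The bent chain, and failure of larger exponents. -/

section Sharpness

variable {d n : ℕ} {K : Set (Euc d)} {τ : Fin n → ℝ}

/-- The centers of consecutively touching intervals of half-lengths `τ i`. -/
noncomputable def chainCenter (τ : Fin n → ℝ) (i : Fin n) : ℝ :=
  2 * ∑ j ∈ Finset.Iio i, τ j + τ i

theorem chainCenter_succ_sub (τ : Fin n → ℝ) {i j : Fin n} (hij : j.val = i.val + 1) :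
    chainCenter τ j - chainCenter τ i = τ i + τ j := by
  have h : Finset.Iio j = insert i (Finset.Iio i) := by
    ext l
    simp only [Finset.mem_Iio, Finset.mem_insert, Fin.lt_def, Fin.ext_iff]
    omega
  rw [chainCenter, chainCenter, h, Finset.sum_insert (by simp)]
  ring

theorem chainCenter_of_val_eq_zero (τ : Fin n → ℝ) {i : Fin n} (hi : i.val = 0) :
    chainCenter τ i = τ i := by
  have h : Finset.Iio i = ∅ := by
    ext l
    simp [Fin.lt_def, hi]
  rw [chainCenter, h]
  simp

theorem chainCenter_last_add (τ : Fin n → ℝ) {i : Fin n} (hi : i.val + 1 = n) :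
    chainCenter τ i + τ i = 2 * ∑ j, τ j := by
  have h : Finset.univ = insert i (Finset.Iio i) := by
    ext l
    simp only [Finset.mem_univ, Finset.mem_Iio, Finset.mem_insert, Fin.lt_def, Fin.ext_iff,
      true_iff]
    have := l.isLt
    omega
  rw [h, Finset.sum_insert (by simp), chainCenter]
  ring

/-- A lower bound for the circumradius from the width in one direction. -/
theorem le_circumradius_of_width (hK : IsSymmConvexBody K) {u : Euc d} {ρ : ℝ} (hρ : 0 < ρ)
    (hu : ‖u‖ = 1) (hball : Metric.closedBall 0 ρ ⊆ K) (hwidth : ∀ y ∈ K, inner ℝ u y ≤ ρ)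
    {p : Fin n → Euc d} (i j : Fin n) {lam : ℝ}
    (h : 2 * lam * ρ ≤ inner ℝ u (p j - p i) + (τ i + τ j) * ρ) :
    lam ≤ circumradius K (⋃ i, homothets K τ p i) := by
  -- The set of admissible factors must be shown nonempty, since `sInf ∅ = 0` would spoil the bound.
  refine le_csInf ?_ ?_
  · have hb : Bornology.IsBounded (⋃ i, homothets K τ p i) :=
      (isCompact_iUnion fun i => (hK.isCompact.smul (τ i)).vadd (p i)).isBounded
    obtain ⟨M, hM⟩ := hb.subset_closedBall 0
    have hM1 : 0 < (max M 1) / ρ := by positivity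
    refine ⟨max M 1 / ρ, hM1, 0, fun x hx => ?_⟩
    rw [zero_vadd, Set.mem_smul_set_iff_inv_smul_mem₀ hM1.ne']
    apply hball
    have h1 : ‖x‖ ≤ max M 1 := (mem_closedBall_zero_iff.1 (hM hx)).trans (le_max_left _ _)
    rw [mem_closedBall_zero_iff, norm_smul, norm_inv, Real.norm_of_nonneg hM1.le,
      inv_mul_le_iff₀ hM1, div_mul_cancel₀ _ hρ.ne']
    exact h1
  · rintro l ⟨hl, q, hq⟩
    have hw : ρ • u ∈ K := hball (by
      rw [mem_closedBall_zero_iff, norm_smul, hu, mul_one, Real.norm_of_nonneg hρ.le])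
    have huw : inner ℝ u (ρ • u) = ρ := by
      rw [real_inner_smul_right, real_inner_self_eq_norm_sq, hu, one_pow, mul_one]
    have key : ∀ x ∈ ⋃ i, homothets K τ p i, |inner ℝ u x - inner ℝ u q| ≤ l * ρ := by
      intro x hx
      obtain ⟨y', hy', rfl⟩ := Set.mem_vadd_set.1 (hq hx)
      obtain ⟨y, hy, rfl⟩ := Set.mem_smul_set.1 hy'
      rw [vadd_eq_add, inner_add_right, add_sub_cancel_left, real_inner_smul_right, abs_mul,
        abs_of_pos hl]
      gcongr
      refine abs_le.2 ⟨?_, hwidth y hy⟩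
      have := hwidth (-y) (hK.symm y hy)
      rw [inner_neg_right] at this
      linarith
    have h1 := (abs_le.1 (key (p j + τ j • (ρ • u))
      (Set.mem_iUnion.2 ⟨j, mem_homothets_iff.2 ⟨_, hw, rfl⟩⟩))).2
    have h2 := (abs_le.1 (key (p i + τ i • -(ρ • u))
      (Set.mem_iUnion.2 ⟨i, mem_homothets_iff.2 ⟨_, hK.symm _ hw, rfl⟩⟩))).1
    rw [inner_add_right, real_inner_smul_right, huw] at h1
    rw [inner_add_right, real_inner_smul_right, inner_neg_right, huw] at h2
    rw [inner_sub_right] at h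
    have : lam * ρ ≤ l * ρ := by linarith
    exact le_of_mul_le_mul_right this hρ

/-- Touching chains bent at one member have nearly maximal circumradius. -/
theorem exists_bent_chain (hd : 2 ≤ d) (hn : 3 ≤ n) (hK : IsSymmConvexBody K)
    (hτ : ∀ i, 0 < τ i) :
    ∃ c : ℝ, 0 < c ∧ ∃ ε₀ : ℝ, 0 < ε₀ ∧ ∀ ε : ℝ, 0 < ε → ε ≤ ε₀ →
      ∃ p : Fin n → Euc d, IsNSFamily (homothets K τ p) ∧
        (∑ i, τ i) - ε ≤ circumradius K (⋃ i, homothets K τ p i) ∧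
        ∀ L : AffineSubspace ℝ (Euc d), IsLine L →
          ∃ i, c * ε ^ (1 / 2 : ℝ) ≤ Metric.infDist (p i) (L : Set (Euc d)) := by
  obtain ⟨ρ, u, z, hρ, hu, hz, huz, hball, hwidth⟩ := hK.exists_inscribed_ball hd
  have hne : K.Nonempty := hK.nonempty_interior.mono interior_subset
  set i0 : Fin n := ⟨0, by omega⟩ with hi0
  set i1 : Fin n := ⟨1, by omega⟩ with hi1
  set i2 : Fin n := ⟨2, by omega⟩ with hi2
  set il : Fin n := ⟨n - 1, by omega⟩ with hil
  set T := ∑ i, τ i with hT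
  have hT0 : 0 < T := lt_of_lt_of_le (hτ i0)
    (Finset.single_le_sum (fun i _ => (hτ i).le) (Finset.mem_univ i0))
  refine ⟨ρ * τ i1 / (8 * √T), by have := hτ i1; positivity, T / 2, by positivity,
    fun ε hε hεT => ?_⟩
  set η := ε / T with hη
  have hη0 : 0 < η := by positivity
  have hη2 : η ≤ 1 / 2 := by
    rw [hη, div_le_iff₀ hT0]
    linarith
  have hηT : η * T = ε := by rw [hη]; field_simp
  set s := √η with hs
  have hs0 : 0 ≤ s := Real.sqrt_nonneg _
  have hs2 : s ^ 2 = η := Real.sq_sqrt hη0.le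
  have hs1 : s ≤ 1 := Real.sqrt_le_one.2 (by linarith)
  -- Only the second member is displaced; as `n ≥ 3`, it has a neighbour on each side, so the
  -- displacement bends the chain.
  set y : Fin n → ℝ := fun i => if i.val = 1 then s * τ i else 0 with hy
  have hy_nonneg : ∀ i, 0 ≤ y i := fun i => by
    simp only [hy]
    split_ifs
    · exact mul_nonneg hs0 (hτ i).le
    · exact le_rfl
  have hy_le : ∀ i, y i ≤ s * τ i := fun i => by
    simp only [hy]
    split_ifs
    · exact le_rfl
    · exact mul_nonneg hs0 (hτ i).le
  set p : Fin n → Euc d := fun i => (ρ * ((1 - η) * chainCenter τ i)) • u + (ρ * y i) • z with hp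
  have hpsub : ∀ i j, p j - p i =
      (ρ * ((1 - η) * (chainCenter τ j - chainCenter τ i))) • u + (ρ * (y j - y i)) • z :=
    fun i j => by
      simp only [hp]
      module
  have hup : ∀ i j, inner ℝ u (p j - p i) =
      ρ * ((1 - η) * (chainCenter τ j - chainCenter τ i)) := fun i j => by
    rw [hpsub, inner_add_right, real_inner_smul_right, real_inner_smul_right, huz,
      real_inner_self_eq_norm_sq, hu]
    ring
  refine ⟨p, ?_, ?_, fun L hL => ?_⟩
  · refine isNSFamily_of_chain (fun i => hK.convex.homothets i) (fun i j hij => ?_)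
      (fun i => ?_)
    · have hD : 0 < τ i + τ j := add_pos (hτ i) (hτ j)
      have hnorm : ‖p j - p i‖ ^ 2 ≤ (ρ * (τ i + τ j)) ^ 2 := by
        have h1 : ‖p j - p i‖ ^ 2 =
            ρ ^ 2 * ((1 - η) ^ 2 * (τ i + τ j) ^ 2 + (y j - y i) ^ 2) := by
          rw [hpsub, chainCenter_succ_sub τ hij, norm_add_sq_real, norm_smul, norm_smul, hu, hz,
            real_inner_smul_left, real_inner_smul_right, huz, Real.norm_eq_abs,
            Real.norm_eq_abs, mul_one, mul_one, sq_abs, sq_abs]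
          ring
        have h2 : (y j - y i) ^ 2 ≤ (s * (τ i + τ j)) ^ 2 := by
          refine sq_le_sq' ?_ ?_
          · have := hy_le i
            have := hy_nonneg j
            have := mul_nonneg hs0 (hτ j).le
            linarith
          · have := hy_le j
            have := hy_nonneg i
            have := mul_nonneg hs0 (hτ i).le
            linarith
        -- With `s² = η` the left side is `1 - η + η²`: shortening by `η` pays for a sideways shift
        -- of order `√η`.
        have h3 : (1 - η) ^ 2 + s ^ 2 ≤ 1 := by
          rw [hs2]
          nlinarith
        rw [h1, mul_pow]
        gcongr
        calc _ ≤ (1 - η) ^ 2 * (τ i + τ j) ^ 2 + (s * (τ i + τ j)) ^ 2 := by gcongr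
          _ = ((1 - η) ^ 2 + s ^ 2) * (τ i + τ j) ^ 2 := by ring
          _ ≤ 1 * (τ i + τ j) ^ 2 := by gcongr
          _ = _ := one_mul _
      have hnorm' : ‖p j - p i‖ ≤ ρ * (τ i + τ j) :=
        abs_le_of_sq_le_sq' hnorm (by positivity) |>.2
      set κ := (τ i + τ j)⁻¹ • (p j - p i) with hκ
      have hκK : κ ∈ K := hball (by
        rw [mem_closedBall_zero_iff, hκ, norm_smul, norm_inv, Real.norm_of_nonneg hD.le,
          inv_mul_le_iff₀ hD, mul_comm]
        exact hnorm')
      have hκD : (τ i + τ j) • κ = p j - p i := by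
        rw [hκ, smul_smul, mul_inv_cancel₀ hD.ne', one_smul]
      refine ⟨p i + τ i • κ, mem_homothets_iff.2 ⟨κ, hκK, rfl⟩,
        mem_homothets_iff.2 ⟨-κ, hK.symm _ hκK, ?_⟩⟩
      have : p j = p i + (τ i + τ j) • κ := by rw [hκD]; abel
      rw [this]
      module
    · obtain ⟨v, hv⟩ := hne
      exact ⟨_, mem_homothets_iff.2 ⟨v, hv, rfl⟩⟩
  · refine le_circumradius_of_width hK hρ hu hball hwidth i0 il ?_
    have h1 := chainCenter_last_add τ (i := il) (by simp only [hil]; omega)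
    have h2 := chainCenter_of_val_eq_zero τ (i := i0) rfl
    rw [hup, h2, ← hηT, show chainCenter τ il = 2 * T - τ il by linarith]
    have h3 : 0 ≤ η * (τ i0 + τ il) * ρ := by
      have := hτ i0
      have := hτ il
      positivity
    linarith
  · by_contra! hcon
    have h01 := chainCenter_succ_sub τ (i := i0) (j := i1) rfl
    have h12 := chainCenter_succ_sub τ (i := i1) (j := i2) rfl
    have h0 := hτ i0
    have h1 := hτ i1
    have h2 := hτ i2
    have e0 : y i0 = 0 := by simp [hy, hi0]
    have e1 : y i1 = s * τ i1 := by simp [hy, hi1]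
    have e2 : y i2 = 0 := by simp [hy, hi2]
    have hη1 : 0 ≤ 1 - η := by linarith
    obtain ⟨r, hr, hrlt⟩ : ∃ r, (∀ i ∈ ({i0, i1, i2} : Finset (Fin n)),
        Metric.infDist (p i) (L : Set (Euc d)) ≤ r) ∧
        r < ρ * τ i1 / (8 * √T) * ε ^ (1 / 2 : ℝ) := by
      obtain ⟨i, -, hi⟩ := Finset.exists_max_image ({i0, i1, i2} : Finset (Fin n))
        (fun i => Metric.infDist (p i) (L : Set (Euc d))) ⟨i0, by simp⟩
      exact ⟨_, hi, hcon i⟩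
    have hfar := hL.exists_le_infDist (a := p i0) (b := p i1) (c := p i2) hu hz huz
      (x := ρ * ((1 - η) * (τ i0 + τ i1))) (y := ρ * (s * τ i1))
      (X := ρ * ((1 - η) * (τ i0 + τ i1 + (τ i1 + τ i2)))) (by positivity)
      (mul_le_mul_of_nonneg_left (mul_le_mul_of_nonneg_left (by linarith) hη1) hρ.le)
      (by positivity)
      (by
        refine mul_le_mul_of_nonneg_left ?_ hρ.le
        have : s * τ i1 ≤ 1 * τ i1 := by gcongr
        have : 1 / 2 * (τ i0 + τ i1 + (τ i1 + τ i2)) ≤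
          (1 - η) * (τ i0 + τ i1 + (τ i1 + τ i2)) := by
          gcongr
          linarith
        linarith)
      (by rw [hpsub, h01, e0, e1, sub_zero])
      (by
        rw [hpsub, e0, e2, sub_zero, mul_zero, zero_smul, add_zero,
          show chainCenter τ i2 - chainCenter τ i0 = τ i0 + τ i1 + (τ i1 + τ i2) by linarith])
      (hr i0 (by simp)) (hr i1 (by simp)) (hr i2 (by simp))
    have hsT : s = √ε / √T := by rw [hs, hη, Real.sqrt_div hε.le]
    rw [← Real.sqrt_eq_rpow] at hrlt
    have : ρ * τ i1 / (8 * √T) * √ε = ρ * (s * τ i1) / 8 := by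
      rw [hsT]
      field_simp
    linarith

/-- A lower bound of order `√ε` rules out every stability exponent above `1 / 2`. -/
theorem not_hasStabilityExponent_of_lower_bound {c ε₀ : ℝ} (hc : 0 < c) (hε₀ : 0 < ε₀)
    (h : ∀ ε : ℝ, 0 < ε → ε ≤ ε₀ →
      ∃ p : Fin n → Euc d, IsNSFamily (homothets K τ p) ∧
        (∑ i, τ i) - ε ≤ circumradius K (⋃ i, homothets K τ p i) ∧
        ∀ L : AffineSubspace ℝ (Euc d), IsLine L →
          ∃ i, c * ε ^ (1 / 2 : ℝ) ≤ Metric.infDist (p i) (L : Set (Euc d)))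
    {α : ℝ} (hα : 1 / 2 < α) : ¬ HasStabilityExponent K τ α := by
  rintro ⟨C, hC, D, hD, hstab⟩
  -- The two bounds together would give `c ≤ C ε ^ (α - 1 / 2)` for all small `ε`, but the right
  -- side tends to `0`.
  have hlim : Filter.Tendsto (fun ε : ℝ => C * ε ^ (α - 1 / 2)) (nhdsWithin 0 (Set.Ioi 0))
      (nhds 0) := by
    have h1 : ContinuousAt (fun ε : ℝ => C * ε ^ (α - 1 / 2)) 0 :=
      (Real.continuousAt_rpow_const 0 _ (Or.inr (by linarith))).const_mul C
    have h2 := h1.tendsto.mono_left (nhdsWithin_le_nhds (s := Set.Ioi 0))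
    rwa [Real.zero_rpow (by linarith), mul_zero] at h2
  have hsmall : ∀ᶠ ε : ℝ in nhdsWithin 0 (Set.Ioi 0), ε < min ε₀ D :=
    (eventually_lt_nhds (lt_min hε₀ hD)).filter_mono nhdsWithin_le_nhds
  obtain ⟨ε, hεc, hεmin, hε0⟩ :=
    ((hlim.eventually_lt_const hc).and (hsmall.and self_mem_nhdsWithin)).exists
  have hε : (0 : ℝ) < ε := hε0
  obtain ⟨p, hNS, hcirc, hfar⟩ := h ε hε (hεmin.le.trans (min_le_left _ _))
  obtain ⟨L, hL, hLp⟩ := hstab p hNS ε hε (hεmin.le.trans (min_le_right _ _)) hcirc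
  obtain ⟨i, hi⟩ := hfar L hL
  have h1 := hi.trans (hLp i)
  have h2 : ε ^ α = ε ^ (α - 1 / 2) * ε ^ (1 / 2 : ℝ) := by
    rw [← Real.rpow_add hε]
    ring_nf
  rw [h2, ← mul_assoc] at h1
  have := le_of_mul_le_mul_right h1 (Real.rpow_pos_of_pos hε _)
  linarith

end Sharpness

theorem mainTheorem8 {d n : ℕ} (hd : 2 ≤ d) (hn : 1 ≤ n)
    (K : Set (Euc d)) (hK : IsSymmConvexBody K) (hC2 : HasC2Boundary K)
    (hcurv : HasPosGaussianCurvature K)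
    (τ : Fin n → ℝ) (hτ : ∀ i, 0 < τ i) :
    HasStabilityExponent K τ (1 / 2) ∧
    (3 ≤ n →
      (∃ c : ℝ, 0 < c ∧ ∃ ε₀ : ℝ, 0 < ε₀ ∧ ∀ ε : ℝ, 0 < ε → ε ≤ ε₀ →
        ∃ p : Fin n → Euc d, IsNSFamily (homothets K τ p) ∧
          (∑ i, τ i) - ε ≤ circumradius K (⋃ i, homothets K τ p i) ∧
          ∀ L : AffineSubspace ℝ (Euc d), IsLine L →
            ∃ i, c * ε ^ (1 / 2 : ℝ) ≤ Metric.infDist (p i) (L : Set (Euc d))) ∧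
      ∀ α : ℝ, 1 / 2 < α → ¬ HasStabilityExponent K τ α) := by
  refine ⟨hasStabilityExponent_half hn hK hC2 hcurv hτ, fun hn3 => ?_⟩
  obtain ⟨c, hc, ε₀, hε₀, h⟩ := exists_bent_chain hd hn3 hK hτ
  exact ⟨⟨c, hc, ε₀, hε₀, h⟩, fun α hα => not_hasStabilityExponent_of_lower_bound hc hε₀ h hα⟩
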